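/- Let $\mathbb K$ be a field and let $T$ be a finite non-empty set, the set of kinds of two-point vertices (for example $T=\{\text{mass},\text{wave function}\}$, or a one-point set if the kinds are not distinguished). A *Feynman graph* $G$ is a finite graph (multiple edges and self-loops allowed) with internal edges and unlabelled external legs, each of whose vertices either has valence $4$ or has valence $2$ and carries a kind in $T$; it has at least one internal edge and is one-particle irreducible (1PI), i.e. connected and still connected after cutting any one internal edge. The number of legs is arbitrary; if it equals $2$, the graph also carries a kind in $T$, the kind of the vertex that replaces it when it is shrunk. Graphs are taken up to isomorphism. A *scale assignment* $\mu$ of $G$ gives a scale $\mu(e)\in\{0,1,2,\dots\}$ to each internal edge $e$; an *assigned graph* is an isomorphism class of pairs $(G,\mu)$. Let $\mathcal H_{\mathrm{CK}}$ and $\widetilde{\mathcal H}$ be the commutative $\mathbb K$-algebras freely generated by the Feynman graphs and by the assigned graphs respectively (the product is disjoint union, $1$ is the empty graph). For a Feynman graph $G$ let $\mathcal E(G)$ be the set of pairs $(g,\kappa)$, where $g$ is a set of internal edges of $G$, possibly empty but not all of them, such that each connected component $g_1,\dots,g_k$ of the subgraph with edge set $g$ is 1PI with two or four external legs (the legs of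 a component being the half-edges of $G$ at its vertices that do not belong to edges of $g$), and $\kappa$ chooses a kind in $T$ for each component with two legs. Let $g_{i,\kappa}$ be the $i$-th component with the chosen kind, and let $G/(g,\kappa)$ be obtained from $G$ by shrinking each component to a vertex, of the chosen kind if it has valence $2$. Define algebra morphisms $\Delta$ and $\varepsilon$ on both algebras by $\varepsilon(G)=0$ and $$\Delta(G)=G\otimes 1+\sum_{(g,\kappa)\in\mathcal E(G)} \Big(\prod_{i} g_{i,\kappa}\Big)\otimes G/(g,\kappa)$$ on generators (the term with $g=\emptyset$ is $1\otimes G$); for an assigned graph $(G,\mu)$ the same formula is used, with $\mu$ restricted to the internal edges of the components and of the cograph, and without any condition on the scales. Then $\mathcal H_{\mathrm{CK}}$ and $\widetilde{\mathcal H}$, with these coproducts and counits, are Hopf algebras, and for every integer $\rho\ge 0$ the algebra morphism $\pi^\rho_{\mathrm{CK}}:\mathcal H_{\mathrm{CK}}\to\widetilde{\mathcal H}$ defined on generators by $$\pi^\rho_{\mathrm{CK}}(G)=\sum_{|\mu|\le\rho}(G,\mu),$$ the sum running over all scale assignments $\mu$ of $G$ with $\mu(e)\le\rho$ for every internal edge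 $e$, is a morphism of Hopf algebras: it is compatible with the coproducts, the counits and the antipodes. -/

import Mathlib

open scoped TensorProduct

/-! ### Graphs -/

/-- A finite multigraph with external legs.  `V`, `E`, `L` are the vertices, the internal edges and
the external legs; the half-edge `(e, b)` of the internal edge `e` is attached to `ends e b`, the
leg `l` to `att l`.  Edges carry a label in `S` (a scale, or no information if `S = Unit`).
The type of a vertex is `none` (quartic interaction vertex) or `some t` with `t : T` (bivalent vertex
of kind `t`, e.g. mass or wave function).  In the same way `res` is the vertex type that replaces the
whole graph when it is shrunk. -/
structure FGraph (T S : Type) : Type 1 where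
  V : Type
  E : Type
  L : Type
  finV : Finite V
  finE : Finite E
  finL : Finite L
  ends : E → Bool → V
  att : L → V
  kind : V → Option T
  res : Option T
  lab : E → S

namespace FGraph

attribute [instance] FGraph.finV FGraph.finE FGraph.finL

variable {T S : Type}

/-- The partition of the vertices into connected components when only the edges in `F` are kept. -/
def joined (G : FGraph T S) (F : Set G.E) : Setoid G.V :=
  Relation.EqvGen.setoid fun v w => ∃ e ∈ F, G.ends e false = v ∧ G.ends e true = w

/-- The connected components of the graph with all vertices of `G` and edge set `F`. -/
abbrev Comp (G : FGraph T S) (F : Set G.E) : Type := Quotient (G.joined F)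

/-- The component of the vertex `v`. -/
abbrev cls (G : FGraph T S) (F : Set G.E) (v : G.V) : G.Comp F := Quotient.mk (G.joined F) v

/-- The half-edges (halves of internal edges, and legs) attached to `v`. -/
abbrev Star (G : FGraph T S) (v : G.V) : Type :=
  {p : G.E × Bool // G.ends p.1 p.2 = v} ⊕ {l : G.L // G.att l = v}

/-- The valence of a vertex; a self-loop counts twice. -/
noncomputable def valence (G : FGraph T S) (v : G.V) : ℕ := Nat.card (G.Star v)

/-- The number of external legs. -/
noncomputable def legs (G : FGraph T S) : ℕ := Nat.card G.L

/-- All vertices lie in one component when only the edges in `F` are kept. -/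
def ConnectedOn (G : FGraph T S) (F : Set G.E) : Prop :=
  Nonempty G.V ∧ ∀ v w, (G.joined F).r v w

/-- One particle irreducible: there is an internal edge, the graph is connected, and it remains
connected when any one internal edge is cut. -/
def IsOnePI (G : FGraph T S) : Prop :=
  Nonempty G.E ∧ G.ConnectedOn Set.univ ∧ ∀ e : G.E, G.ConnectedOn {e}ᶜ

/-- The vertices are quartic, or bivalent of a given kind. -/
def IsPhi4 (G : FGraph T S) : Prop :=
  ∀ v, (G.valence v = 4 ∧ G.kind v = none) ∨ (G.valence v = 2 ∧ (G.kind v).isSome)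

/-- One particle irreducible graphs of the quartic scalar theory, with any number of legs; exactly
the graphs with two legs carry a kind of two-point function. -/
structure IsFeynman (G : FGraph T S) : Prop where
  phi4 : G.IsPhi4
  onePI : G.IsOnePI
  res_iff : G.legs = 2 ↔ G.res.isSome

/-- An isomorphism of labelled graphs.  Legs may be permuted and edges have no direction. -/
structure Iso (G G' : FGraph T S) where
  v : G.V ≃ G'.V
  e : G.E ≃ G'.E
  l : G.L ≃ G'.L
  ends : ∀ x, (∀ b, G'.ends (e x) b = v (G.ends x b)) ∨ (∀ b, G'.ends (e x) (!b) = v (G.ends x b))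
  att : ∀ x, G'.att (l x) = v (G.att x)
  kind : ∀ x, G'.kind (v x) = G.kind x
  res : G'.res = G.res
  lab : ∀ x, G'.lab (e x) = G.lab x

/-- The component `c` of the subgraph with edge set `F`, as a graph with residue `r`.  Its legs are
the half-edges of `G` at its vertices that do not belong to edges of `F`. -/
def component (G : FGraph T S) (F : Set G.E) (c : G.Comp F) (r : Option T) : FGraph T S where
  V := {v : G.V // G.cls F v = c}
  E := {e : G.E // e ∈ F ∧ ∀ b, G.cls F (G.ends e b) = c}
  L := {p : G.E × Bool // p.1 ∉ F ∧ G.cls F (G.ends p.1 p.2) = c} ⊕ {l : G.L // G.cls F (G.att l) = c}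
  finV := inferInstance
  finE := inferInstance
  finL := inferInstance
  ends := fun e b => ⟨G.ends e.1 b, e.2.2 b⟩
  att := Sum.elim (fun p => ⟨G.ends p.1.1 p.1.2, p.2.2⟩) (fun l => ⟨G.att l.1, l.2⟩)
  kind := fun v => G.kind v.1
  res := r
  lab := fun e => G.lab e.1

/-- The graph obtained by shrinking every component of the subgraph with edge set `F` to a vertex;
the new vertices have the types given by `κ`. -/
def contract (G : FGraph T S) (F : Set G.E) (κ : G.Comp F → Option T) : FGraph T S where
  V := G.Comp F
  E := {e : G.E // e ∉ F}
  L := G.L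
  finV := inferInstance
  finE := inferInstance
  finL := inferInstance
  ends := fun e b => G.cls F (G.ends e.1 b)
  att := fun l => G.cls F (G.att l)
  kind := κ
  res := G.res
  lab := fun e => G.lab e.1

/-- The component `c` contains an edge of `F`; the other components are single vertices of `G` that
do not belong to the subgraph. -/
def Nontrivial (G : FGraph T S) (F : Set G.E) (c : G.Comp F) : Prop :=
  ∃ e ∈ F, ∃ b, G.cls F (G.ends e b) = c

/-- The data of a term of the coproduct: a proper (possibly empty, possibly disconnected) subgraph,
given by its edges, whose components are one particle irreducible with two or four legs, together
with a kind for each component with two legs.  The vertices outside of the subgraph keep their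
type. -/
structure IsExtraction (G : FGraph T S) (F : Set G.E) (κ : G.Comp F → Option T) : Prop where
  proper : F ≠ Set.univ
  onePI : ∀ c, G.Nontrivial F c → (G.component F c (κ c)).IsOnePI
  legs : ∀ c, G.Nontrivial F c →
    (G.component F c (κ c)).legs = 2 ∨ (G.component F c (κ c)).legs = 4
  kind_iff : ∀ c, G.Nontrivial F c → ((G.component F c (κ c)).legs = 2 ↔ (κ c).isSome)
  kind_eq : ∀ v, ¬ G.Nontrivial F (G.cls F v) → κ (G.cls F v) = G.kind v

/-- The terms of the coproduct of `G` other than `G ⊗ 1`. -/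
def Extraction (G : FGraph T S) : Type :=
  {D : (Σ F : Set G.E, (G.Comp F → Option T)) // G.IsExtraction D.1 D.2}

/-- Replacing the labels of the internal edges. -/
def relabel {S' : Type} (G : FGraph T S) (μ : G.E → S') : FGraph T S' :=
  { G with lab := μ }


/-! ### Well-definedness: the pieces of an extraction are again Feynman graphs -/

theorem cls_ends (G : FGraph T S) {F : Set G.E} {e : G.E} (he : e ∈ F) (b b' : Bool) :
    G.cls F (G.ends e b) = G.cls F (G.ends e b') := by
  have h : G.cls F (G.ends e false) = G.cls F (G.ends e true) :=
    Quotient.sound (Relation.EqvGen.rel _ _ ⟨e, he, rfl, rfl⟩)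
  cases b <;> cases b' <;> simp [h]

theorem nontrivial_iff (G : FGraph T S) (F : Set G.E) (c : G.Comp F) (r : Option T) :
    G.Nontrivial F c ↔ Nonempty (G.component F c r).E := by
  constructor
  · rintro ⟨e, he, b, hb⟩
    exact ⟨⟨e, he, fun b' => (G.cls_ends he b' b).trans hb⟩⟩
  · rintro ⟨e, he, hb⟩
    exact ⟨e, he, true, hb true⟩

theorem cls_eq_of_not_nontrivial (G : FGraph T S) {F : Set G.E} {v : G.V}
    (hv : ¬ G.Nontrivial F (G.cls F v)) (w : G.V) : G.cls F w = G.cls F v ↔ w = v := by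
  constructor
  · intro h
    have h1 : Relation.EqvGen (fun v w => ∃ e ∈ F, G.ends e false = v ∧ G.ends e true = w) w v :=
      Quotient.exact h
    have key : ∀ x y, Relation.EqvGen
        (fun v w => ∃ e ∈ F, G.ends e false = v ∧ G.ends e true = w) x y →
        (G.cls F x = G.cls F v → x = y) := by
      intro x y hxy
      induction hxy with
      | rel x y h =>
        obtain ⟨e, he, h1, h2⟩ := h
        intro hx
        exact absurd ⟨e, he, false, h1 ▸ hx⟩ hv
      | refl x => intro _; rfl
      | symm x y h ih =>
        intro hy
        have : G.cls F x = G.cls F y := Quotient.sound h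
        exact (ih (this.trans hy)).symm
      | trans x y z h1 h2 ih1 ih2 =>
        intro hx
        have := ih1 hx
        subst this
        exact ih2 hx
    exact key w v h1 h
  · rintro rfl; rfl

/-- The half-edges at a vertex of a component, as half-edges of the whole graph. -/
def starMap (G : FGraph T S) (F : Set G.E) (c : G.Comp F) (r : Option T)
    (v : (G.component F c r).V) : (G.component F c r).Star v → G.Star v.1
  | Sum.inl p => Sum.inl ⟨(p.1.1.1, p.1.2), congrArg Subtype.val p.2⟩
  | Sum.inr ⟨Sum.inl p, h⟩ => Sum.inl ⟨p.1, congrArg Subtype.val h⟩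
  | Sum.inr ⟨Sum.inr l, h⟩ => Sum.inr ⟨l.1, congrArg Subtype.val h⟩

theorem component_valence (G : FGraph T S) (F : Set G.E) (c : G.Comp F) (r : Option T)
    (v : (G.component F c r).V) : (G.component F c r).valence v = G.valence v.1 := by
  refine Nat.card_congr (Equiv.ofBijective (G.starMap F c r v) ⟨?_, ?_⟩)
  · rintro (⟨⟨⟨e, he⟩, b⟩, h⟩ | ⟨⟨⟨e, b⟩, he⟩ | ⟨l, hl⟩, h⟩)
      (⟨⟨⟨e', he'⟩, b'⟩, h'⟩ | ⟨⟨⟨e', b'⟩, he'⟩ | ⟨l', hl'⟩, h'⟩) hh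
    all_goals simp only [starMap, Sum.inl.injEq, Sum.inr.injEq, reduceCtorEq] at hh
    · obtain ⟨rfl, rfl⟩ := hh; rfl
    · obtain ⟨rfl, rfl⟩ := hh; exact absurd he.1 he'.1
    · obtain ⟨rfl, rfl⟩ := hh; exact absurd he'.1 he.1
    · obtain ⟨rfl, rfl⟩ := hh; rfl
    · obtain rfl : l = l' := congrArg Subtype.val hh
      rfl
  · obtain ⟨v, hv⟩ := v
    rintro (⟨⟨e, b⟩, h⟩ | ⟨l, h⟩)
    · have h : G.ends e b = v := h
      by_cases he : e ∈ F
      · exact ⟨Sum.inl ⟨(⟨e, he, fun b' => (G.cls_ends he b' b).trans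
          ((congrArg (G.cls F) h).trans hv)⟩, b), Subtype.ext h⟩, rfl⟩
      · exact ⟨Sum.inr ⟨Sum.inl ⟨(e, b), he, (congrArg (G.cls F) h).trans hv⟩,
          Subtype.ext h⟩, rfl⟩
    · have h : G.att l = v := h
      exact ⟨Sum.inr ⟨Sum.inr ⟨l, (congrArg (G.cls F) h).trans hv⟩, Subtype.ext h⟩, rfl⟩

theorem contract_valence (G : FGraph T S) (F : Set G.E) (κ : G.Comp F → Option T) (c : G.Comp F)
    (r : Option T) : (G.contract F κ).valence c = (G.component F c r).legs := by
  refine Nat.card_congr (Equiv.sumCongr ?_ (Equiv.refl _))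
  exact
    { toFun := fun p => ⟨(p.1.1.1, p.1.2), p.1.1.2, p.2⟩
      invFun := fun p => ⟨(⟨p.1.1, p.2.1⟩, p.1.2), p.2.2⟩
      left_inv := fun _ => rfl
      right_inv := fun _ => rfl }

theorem legs_of_not_nontrivial (G : FGraph T S) {F : Set G.E} {v : G.V}
    (hv : ¬ G.Nontrivial F (G.cls F v)) (r : Option T) :
    (G.component F (G.cls F v) r).legs = G.valence v := by
  have key := G.cls_eq_of_not_nontrivial hv
  refine Nat.card_congr (Equiv.sumCongr ?_ ?_)
  · exact Equiv.subtypeEquivRight fun p => by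
      rw [key]
      refine ⟨fun h => h.2, fun h => ⟨fun hp => hv ⟨p.1, hp, p.2, congrArg _ h⟩, h⟩⟩
  · exact Equiv.subtypeEquivRight fun l => key _

theorem component_isFeynman {G : FGraph T S} (hG : G.IsFeynman) {F : Set G.E}
    {κ : G.Comp F → Option T} (h : G.IsExtraction F κ) (c : G.Comp F) (hc : G.Nontrivial F c) :
    (G.component F c (κ c)).IsFeynman where
  phi4 := fun v => by
    rw [component_valence]
    exact hG.phi4 v.1
  onePI := h.onePI c hc
  res_iff := h.kind_iff c hc

theorem contract_joined (G : FGraph T S) (F : Set G.E) (κ : G.Comp F → Option T)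
    {A : Set G.E} {B : Set (G.contract F κ).E}
    (hAB : ∀ e, e ∈ A → ∀ he : e ∉ F, (⟨e, he⟩ : {e : G.E // e ∉ F}) ∈ B) {v w : G.V}
    (h : (G.joined A).r v w) :
    ((G.contract F κ).joined B).r (G.cls F v) (G.cls F w) := by
  replace h : Relation.EqvGen (fun v w => ∃ e ∈ A, G.ends e false = v ∧ G.ends e true = w) v w := h
  induction h with
  | rel x y hxy =>
    obtain ⟨e, he, rfl, rfl⟩ := hxy
    by_cases heF : e ∈ F
    · rw [G.cls_ends heF false true]
      exact ((G.contract F κ).joined B).iseqv.refl _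
    · exact Relation.EqvGen.rel _ _ ⟨⟨e, heF⟩, hAB e he heF, rfl, rfl⟩
  | refl x => exact ((G.contract F κ).joined B).iseqv.refl _
  | symm x y _ ih => exact ((G.contract F κ).joined B).iseqv.symm ih
  | trans x y z _ _ ih1 ih2 => exact ((G.contract F κ).joined B).iseqv.trans ih1 ih2

theorem contract_connectedOn (G : FGraph T S) (F : Set G.E) (κ : G.Comp F → Option T)
    {A : Set G.E} {B : Set (G.contract F κ).E}
    (hAB : ∀ e, e ∈ A → ∀ he : e ∉ F, (⟨e, he⟩ : {e : G.E // e ∉ F}) ∈ B)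
    (h : G.ConnectedOn A) : (G.contract F κ).ConnectedOn B := by
  refine ⟨h.1.map (G.cls F), fun c d => ?_⟩
  induction c using Quotient.inductionOn
  induction d using Quotient.inductionOn
  exact G.contract_joined F κ hAB (h.2 _ _)

theorem contract_isFeynman {G : FGraph T S} (hG : G.IsFeynman) {F : Set G.E}
    {κ : G.Comp F → Option T} (h : G.IsExtraction F κ) : (G.contract F κ).IsFeynman where
  phi4 := fun c => by
    rw [G.contract_valence F κ c (κ c)]
    by_cases hc : G.Nontrivial F c
    · have hk : (G.contract F κ).kind c = κ c := rfl
      rcases h.legs c hc with h2 | h4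
      · exact Or.inr ⟨h2, (h.kind_iff c hc).1 h2⟩
      · refine Or.inl ⟨h4, ?_⟩
        have := (h.kind_iff c hc).not.1 (by omega)
        simpa [hk] using this
    · induction c using Quotient.inductionOn with
      | h v =>
        have hk : (G.contract F κ).kind (G.cls F v) = G.kind v := h.kind_eq v hc
        have hl := G.legs_of_not_nontrivial hc (κ (G.cls F v))
        have := hG.phi4 v
        rw [← hk, ← hl] at this
        exact this
  onePI := by
    refine ⟨?_, ?_, fun e => ?_⟩
    · obtain ⟨e, he⟩ := (Set.ne_univ_iff_exists_notMem F).1 h.proper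
      exact ⟨⟨e, he⟩⟩
    · exact G.contract_connectedOn F κ (fun _ _ _ => trivial) hG.onePI.2.1
    · refine G.contract_connectedOn F κ ?_ (hG.onePI.2.2 e.1)
      exact fun x hx hxF hxe => hx (congrArg Subtype.val hxe)
  res_iff := hG.res_iff

theorem relabel_isFeynman {S' : Type} {G : FGraph T S} (hG : G.IsFeynman) (μ : G.E → S') :
    (G.relabel μ).IsFeynman :=
  ⟨hG.phi4, hG.onePI, hG.res_iff⟩

/-! ### Isomorphism classes -/

/-- The identity isomorphism. -/
def Iso.refl (G : FGraph T S) : G.Iso G where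
  v := Equiv.refl _
  e := Equiv.refl _
  l := Equiv.refl _
  ends := fun _ => Or.inl fun _ => rfl
  att := fun _ => rfl
  kind := fun _ => rfl
  res := rfl
  lab := fun _ => rfl

/-- The inverse of an isomorphism. -/
def Iso.symm {G G' : FGraph T S} (f : G.Iso G') : G'.Iso G where
  v := f.v.symm
  e := f.e.symm
  l := f.l.symm
  ends := fun x => by
    rcases f.ends (f.e.symm x) with h | h
    · refine Or.inl fun b => ?_
      have := h b
      rw [Equiv.apply_symm_apply] at this
      rw [this, Equiv.symm_apply_apply]
    · refine Or.inr fun b => ?_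
      have := h (!b)
      rw [Equiv.apply_symm_apply, Bool.not_not] at this
      rw [this, Equiv.symm_apply_apply]
  att := fun x => by
    rw [Equiv.eq_symm_apply, ← f.att, Equiv.apply_symm_apply]
  kind := fun x => by rw [← f.kind, Equiv.apply_symm_apply]
  res := f.res.symm
  lab := fun x => by rw [← f.lab, Equiv.apply_symm_apply]

/-- The composition of isomorphisms. -/
def Iso.trans {G G' G'' : FGraph T S} (f : G.Iso G') (g : G'.Iso G'') : G.Iso G'' where
  v := f.v.trans g.v
  e := f.e.trans g.e
  l := f.l.trans g.l
  ends := fun x => by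
    rcases f.ends x with h | h <;> rcases g.ends (f.e x) with h' | h'
    · exact Or.inl fun b => by simp [h', h]
    · exact Or.inr fun b => by simp [h', h]
    · exact Or.inr fun b => by simp [h', h]
    · refine Or.inl fun b => ?_
      have h1 := h' (!b)
      have h2 := h b
      rw [Bool.not_not] at h1
      simp [h1, h2]
  att := fun x => by simp [g.att, f.att]
  kind := fun x => by simp [g.kind, f.kind]
  res := g.res.trans f.res
  lab := fun x => by simp [g.lab, f.lab]

theorem Iso.ends_cases {G G' : FGraph T S} (f : G.Iso G') (x : G.E) :
    ∃ s : Bool, ∀ b, G'.ends (f.e x) (xor s b) = f.v (G.ends x b) := by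
  rcases f.ends x with h | h
  · exact ⟨false, fun b => by simpa using h b⟩
  · exact ⟨true, fun b => by simpa using h b⟩

theorem Iso.joined_map {G G' : FGraph T S} (f : G.Iso G') (F : Set G.E) {v w : G.V}
    (h : (G.joined F).r v w) : (G'.joined (f.e '' F)).r (f.v v) (f.v w) := by
  replace h : Relation.EqvGen (fun v w => ∃ e ∈ F, G.ends e false = v ∧ G.ends e true = w) v w := h
  induction h with
  | rel x y hxy =>
    obtain ⟨e, he, rfl, rfl⟩ := hxy
    rcases f.ends e with h | h
    · exact Relation.EqvGen.rel _ _ ⟨f.e e, Set.mem_image_of_mem _ he, h _, h _⟩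
    · exact (G'.joined _).iseqv.symm
        (Relation.EqvGen.rel _ _ ⟨f.e e, Set.mem_image_of_mem _ he, h true, h false⟩)
  | refl x => exact (G'.joined _).iseqv.refl _
  | symm x y _ ih => exact (G'.joined _).iseqv.symm ih
  | trans x y z _ _ ih1 ih2 => exact (G'.joined _).iseqv.trans ih1 ih2

theorem Iso.joined_iff {G G' : FGraph T S} (f : G.Iso G') (F : Set G.E) (v w : G.V) :
    (G.joined F).r v w ↔ (G'.joined (f.e '' F)).r (f.v v) (f.v w) := by
  refine ⟨f.joined_map F, fun h => ?_⟩
  have h' := f.symm.joined_map _ h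
  have hF : f.symm.e '' (f.e '' F) = F := by
    ext x
    simp [Iso.symm]
  rw [hF] at h'
  simpa [Iso.symm] using h'

/-- An isomorphism induces a bijection of the components of corresponding subgraphs. -/
def Iso.comp {G G' : FGraph T S} (f : G.Iso G') (F : Set G.E) : G.Comp F ≃ G'.Comp (f.e '' F) :=
  Quotient.congr f.v fun v w => f.joined_iff F v w

theorem Iso.comp_cls {G G' : FGraph T S} (f : G.Iso G') (F : Set G.E) (v : G.V) :
    f.comp F (G.cls F v) = G'.cls (f.e '' F) (f.v v) := rfl

theorem Iso.cls_eq_iff {G G' : FGraph T S} (f : G.Iso G') (F : Set G.E) (v : G.V)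
    (c : G.Comp F) : G.cls F v = c ↔ G'.cls (f.e '' F) (f.v v) = f.comp F c := by
  rw [← f.comp_cls, Equiv.apply_eq_iff_eq]

theorem Iso.connectedOn {G G' : FGraph T S} (f : G.Iso G') {F : Set G.E} (h : G.ConnectedOn F) :
    G'.ConnectedOn (f.e '' F) := by
  refine ⟨h.1.map f.v, fun v w => ?_⟩
  have := f.joined_map F (h.2 (f.v.symm v) (f.v.symm w))
  simpa using this

theorem Iso.isOnePI {G G' : FGraph T S} (f : G.Iso G') (h : G.IsOnePI) : G'.IsOnePI := by
  refine ⟨h.1.map f.e, ?_, fun e => ?_⟩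
  · have := f.connectedOn h.2.1
    rwa [Set.image_univ, f.e.surjective.range_eq] at this
  · have := f.connectedOn (h.2.2 (f.e.symm e))
    rwa [Set.image_compl_eq f.e.bijective, Set.image_singleton, Equiv.apply_symm_apply] at this

theorem Iso.legs_eq {G G' : FGraph T S} (f : G.Iso G') : G'.legs = G.legs :=
  (Nat.card_congr f.l).symm

/-- The orientation-correcting bijection of half-edges. -/
noncomputable def Iso.half {G G' : FGraph T S} (f : G.Iso G') : G.E × Bool ≃ G'.E × Bool where
  toFun := fun p => (f.e p.1, xor (f.ends_cases p.1).choose p.2)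
  invFun := fun p => (f.e.symm p.1, xor (f.ends_cases (f.e.symm p.1)).choose p.2)
  left_inv := fun p => by
    ext
    · simp
    · simp only [Equiv.symm_apply_apply]
      rw [← Bool.xor_assoc, Bool.xor_self, Bool.false_xor]
  right_inv := fun p => by
    ext
    · simp
    · simp only
      rw [← Bool.xor_assoc, Bool.xor_self, Bool.false_xor]

theorem Iso.half_ends {G G' : FGraph T S} (f : G.Iso G') (p : G.E × Bool) :
    G'.ends (f.half p).1 (f.half p).2 = f.v (G.ends p.1 p.2) :=
  (f.ends_cases p.1).choose_spec p.2

/-- Corresponding components are isomorphic. -/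
noncomputable def Iso.component {G G' : FGraph T S} (f : G.Iso G') (F : Set G.E) (c : G.Comp F)
    (r : Option T) :
    (G.component F c r).Iso (G'.component (f.e '' F) (f.comp F c) r) where
  v := f.v.subtypeEquiv fun v => f.cls_eq_iff F v c
  e := f.e.subtypeEquiv fun e => by
    refine and_congr (by simp) ?_
    obtain ⟨s, hs⟩ := f.ends_cases e
    refine ⟨fun h b => ?_, fun h b => ?_⟩
    · have := hs (xor s b)
      rw [← Bool.xor_assoc, Bool.xor_self, Bool.false_xor] at this
      rw [this, ← f.cls_eq_iff]
      exact h _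
    · rw [f.cls_eq_iff, ← hs]
      exact h _
  l := Equiv.sumCongr
    (f.half.subtypeEquiv fun p => and_congr (by simp [Iso.half])
      (by rw [f.half_ends, ← f.cls_eq_iff]))
    (f.l.subtypeEquiv fun l => by rw [f.att, ← f.cls_eq_iff])
  ends := fun x => by
    rcases f.ends x.1 with h | h
    · exact Or.inl fun b => Subtype.ext (h b)
    · exact Or.inr fun b => Subtype.ext (h b)
  att := fun x => by
    rcases x with x | x
    · exact Subtype.ext (f.half_ends x.1)
    · exact Subtype.ext (f.att x.1)
  kind := fun x => f.kind x.1
  res := rfl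
  lab := fun x => f.lab x.1

/-- Corresponding contractions are isomorphic. -/
def Iso.contract {G G' : FGraph T S} (f : G.Iso G') (F : Set G.E) (κ : G.Comp F → Option T) :
    (G.contract F κ).Iso (G'.contract (f.e '' F) (κ ∘ (f.comp F).symm)) where
  v := f.comp F
  e := f.e.subtypeEquiv fun e => by simp
  l := f.l
  ends := fun x => by
    rcases f.ends x.1 with h | h
    · exact Or.inl fun b => congrArg (G'.cls _) (h b)
    · exact Or.inr fun b => congrArg (G'.cls _) (h b)
  att := fun x => congrArg (G'.cls _) (f.att x)
  kind := fun x => congrArg κ ((f.comp F).symm_apply_apply x)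
  res := f.res
  lab := fun x => f.lab x.1

theorem Iso.nontrivial_iff {G G' : FGraph T S} (f : G.Iso G') (F : Set G.E) (c : G.Comp F) :
    G'.Nontrivial (f.e '' F) (f.comp F c) ↔ G.Nontrivial F c := by
  rw [G'.nontrivial_iff _ _ none, G.nontrivial_iff _ _ none]
  exact (f.component F c none).e.nonempty_congr.symm

theorem Iso.isExtraction {G G' : FGraph T S} (f : G.Iso G') {F : Set G.E}
    {κ : G.Comp F → Option T} (h : G.IsExtraction F κ) :
    G'.IsExtraction (f.e '' F) (κ ∘ (f.comp F).symm) where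
  proper := fun hF => h.proper (by
    rw [← Set.preimage_image_eq F f.e.injective, hF, Set.preimage_univ])
  onePI := (f.comp F).surjective.forall.2 fun c hc => by
    simpa using (f.component F c (κ c)).isOnePI (h.onePI c ((f.nontrivial_iff F c).1 hc))
  legs := (f.comp F).surjective.forall.2 fun c hc => by
    simpa [(f.component F c (κ c)).legs_eq] using h.legs c ((f.nontrivial_iff F c).1 hc)
  kind_iff := (f.comp F).surjective.forall.2 fun c hc => by
    simpa [(f.component F c (κ c)).legs_eq] using h.kind_iff c ((f.nontrivial_iff F c).1 hc)
  kind_eq := f.v.surjective.forall.2 fun v hv => by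
    rw [← f.comp_cls, f.nontrivial_iff] at hv
    rw [← f.comp_cls, f.kind]
    simpa using h.kind_eq v hv

/-- The map of extractions induced by an isomorphism. -/
def Iso.extraction {G G' : FGraph T S} (f : G.Iso G') (D : G.Extraction) : G'.Extraction :=
  ⟨⟨f.e '' D.1.1, D.1.2 ∘ (f.comp D.1.1).symm⟩, f.isExtraction D.2⟩

theorem extraction_ext {G : FGraph T S} {D D' : G.Extraction} (h : D.1.1 = D'.1.1)
    (hκ : ∀ v, D.1.2 (G.cls _ v) = D'.1.2 (G.cls _ v)) : D = D' := by
  obtain ⟨⟨F, κ⟩, hD⟩ := D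
  obtain ⟨⟨F', κ'⟩, hD'⟩ := D'
  obtain rfl : F = F' := h
  obtain rfl : κ = κ' := funext fun c => Quotient.inductionOn c hκ
  rfl

theorem Iso.extraction_bijective {G G' : FGraph T S} (f : G.Iso G') :
    Function.Bijective f.extraction := by
  have key : ∀ {H H' : FGraph T S} (g : H.Iso H') (D : H.Extraction),
      g.symm.extraction (g.extraction D) = D := by
    intro H H' g D
    have hF : g.symm.e '' (g.e '' D.1.1) = D.1.1 := by
      ext x
      simp [Iso.symm]
    refine extraction_ext hF fun v => ?_
    have h1 : ∀ v, (g.extraction D).1.2 (H'.cls (g.e '' D.1.1) (g.v v)) = D.1.2 (H.cls _ v) :=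
      fun v => congrArg D.1.2 ((g.comp D.1.1).symm_apply_apply (H.cls _ v))
    have h2 : ∀ v, (g.symm.extraction (g.extraction D)).1.2
        (H.cls (g.symm.e '' (g.e '' D.1.1)) (g.symm.v v)) =
        (g.extraction D).1.2 (H'.cls (g.e '' D.1.1) v) :=
      fun v => congrArg (g.extraction D).1.2 ((g.symm.comp (g.e '' D.1.1)).symm_apply_apply (H'.cls _ v))
    have h3 := h2 (g.v v)
    rw [h1] at h3
    have h4 : g.symm.v (g.v v) = v := g.v.symm_apply_apply v
    rw [h4] at h3
    exact h3
  refine ⟨fun D D' h => ?_, fun D => ⟨f.symm.extraction D, ?_⟩⟩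
  · rw [← key f D, h, key]
  · exact key f.symm D

/-- Relabelling along an isomorphism. -/
def Iso.relabel {S' : Type} {G G' : FGraph T S} (f : G.Iso G') (μ : G.E → S') :
    (G.relabel μ).Iso (G'.relabel (μ ∘ f.e.symm)) where
  v := f.v
  e := f.e
  l := f.l
  ends := f.ends
  att := f.att
  kind := f.kind
  res := f.res
  lab := fun x => congrArg μ (f.e.symm_apply_apply x)

noncomputable instance (G : FGraph T S) [Finite T] : Fintype G.Extraction :=
  @Fintype.ofFinite _ (inferInstanceAs (Finite
    {D : (Σ F : Set G.E, (G.Comp F → Option T)) // G.IsExtraction D.1 D.2}))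

noncomputable instance (G : FGraph T S) : Fintype G.E := Fintype.ofFinite _

end FGraph

/-- Being isomorphic, for one particle irreducible Feynman graphs. -/
def feynmanSetoid (T S : Type) : Setoid {G : FGraph T S // G.IsFeynman} where
  r := fun G G' => Nonempty (G.1.Iso G'.1)
  iseqv :=
    { refl := fun G => ⟨FGraph.Iso.refl G.1⟩
      symm := fun ⟨f⟩ => ⟨f.symm⟩
      trans := fun ⟨f⟩ ⟨g⟩ => ⟨f.trans g⟩ }

/-- Isomorphism classes of one particle irreducible Feynman graphs with edge labels in `S`. -/
def FeynmanClass (T S : Type) : Type 1 := Quotient (feynmanSetoid T S)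

/-! ### The graph Hopf algebras -/

/-- The commutative algebra freely generated by the classes of Feynman graphs with edge labels in
`S`: monomials are disjoint unions, and `1` is the empty graph. -/
def GraphAlgebra (K : Type*) [Field K] (T S : Type) := MvPolynomial (FeynmanClass T S) K

section Algebra

variable (K : Type*) [Field K] {T S : Type}

noncomputable instance : CommRing (GraphAlgebra K T S) :=
  inferInstanceAs (CommRing (MvPolynomial (FeynmanClass T S) K))

noncomputable instance : Algebra K (GraphAlgebra K T S) :=
  inferInstanceAs (Algebra K (MvPolynomial (FeynmanClass T S) K))

/-- The morphism of algebras with given values on the generators. -/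
noncomputable def liftHom {B : Type*} [CommRing B] [Algebra K B] (φ : FeynmanClass T S → B) :
    GraphAlgebra K T S →ₐ[K] B :=
  (MvPolynomial.aeval φ : MvPolynomial (FeynmanClass T S) K →ₐ[K] B)

/-- The generator given by a Feynman graph. -/
noncomputable def gen (G : FGraph T S) (hG : G.IsFeynman) : GraphAlgebra K T S :=
  (MvPolynomial.X (Quotient.mk (feynmanSetoid T S) ⟨G, hG⟩) : MvPolynomial (FeynmanClass T S) K)

theorem gen_congr {G G' : FGraph T S} (hG : G.IsFeynman) (hG' : G'.IsFeynman) (f : G.Iso G') :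
    gen K G hG = gen K G' hG' :=
  congrArg (MvPolynomial.X (R := K)) (Quotient.sound ⟨f⟩)

/-- The disjoint union of the components of the extracted subgraph. -/
noncomputable def extracted {G : FGraph T S} (hG : G.IsFeynman) (D : G.Extraction) :
    GraphAlgebra K T S :=
  ∏ᶠ c : {c : G.Comp D.1.1 // G.Nontrivial D.1.1 c},
    gen K (G.component D.1.1 c.1 (D.1.2 c.1)) (FGraph.component_isFeynman hG D.2 c.1 c.2)

/-- The graph in which the extracted subgraph is shrunk. -/
noncomputable def cograph {G : FGraph T S} (hG : G.IsFeynman) (D : G.Extraction) :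
    GraphAlgebra K T S :=
  gen K (G.contract D.1.1 D.1.2) (FGraph.contract_isFeynman hG D.2)

/-- The coproduct of a Feynman graph: `G ⊗ 1 + 1 ⊗ G + ∑ g ⊗ G / g`, where the term `1 ⊗ G` is the
one of the empty subgraph. -/
noncomputable def comulGraph [Finite T] {G : FGraph T S} (hG : G.IsFeynman) :
    GraphAlgebra K T S ⊗[K] GraphAlgebra K T S :=
  gen K G hG ⊗ₜ[K] 1 + ∑ D : G.Extraction, extracted K hG D ⊗ₜ[K] cograph K hG D

theorem gen_component_congr {G : FGraph T S} {F : Set G.E} {c : G.Comp F} {r r' : Option T}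
    (hr : r = r') (h : (G.component F c r).IsFeynman) (h' : (G.component F c r').IsFeynman) :
    gen K _ h = gen K _ h' := by
  subst hr; rfl

theorem extracted_congr {G G' : FGraph T S} (hG : G.IsFeynman) (hG' : G'.IsFeynman)
    (f : G.Iso G') (D : G.Extraction) :
    extracted K hG D = extracted K hG' (f.extraction D) := by
  refine finprod_eq_of_bijective
    ((f.comp D.1.1).subtypeEquiv fun c => (f.nontrivial_iff D.1.1 c).symm)
    (Equiv.bijective _) fun c => ?_
  have hr : (f.extraction D).1.2 (f.comp D.1.1 c.1) = D.1.2 c.1 :=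
    congrArg D.1.2 ((f.comp D.1.1).symm_apply_apply _)
  have h1 := FGraph.component_isFeynman hG' (f.extraction D).2 (f.comp D.1.1 c.1)
    ((f.nontrivial_iff D.1.1 c.1).2 c.2)
  have h2 : (G'.component (f.e '' D.1.1) (f.comp D.1.1 c.1) (D.1.2 c.1)).IsFeynman := by
    rw [← hr]; exact h1
  exact (gen_congr K _ h2 (f.component D.1.1 c.1 (D.1.2 c.1))).trans
    (gen_component_congr K hr.symm h2 h1)

theorem comulGraph_congr [Finite T] {G G' : FGraph T S} (hG : G.IsFeynman) (hG' : G'.IsFeynman)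
    (f : G.Iso G') : comulGraph K hG = comulGraph K hG' := by
  unfold comulGraph
  rw [gen_congr K hG hG' f]
  congr 1
  refine Fintype.sum_bijective f.extraction f.extraction_bijective _ _ fun D => ?_
  rw [extracted_congr K hG hG' f D]
  congr 1
  exact gen_congr K _ _ (f.contract D.1.1 D.1.2)

variable (T S)

/-- The coproduct, as a morphism of algebras. -/
noncomputable def comulHom [Finite T] :
    GraphAlgebra K T S →ₐ[K] GraphAlgebra K T S ⊗[K] GraphAlgebra K T S :=
  liftHom K (Quotient.lift (fun G => comulGraph K G.2)
    fun G G' ⟨f⟩ => comulGraph_congr K G.2 G'.2 f)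

/-- The counit, which vanishes on all nonempty graphs. -/
noncomputable def counitHom : GraphAlgebra K T S →ₐ[K] K :=
  liftHom K fun _ => 0

noncomputable instance [Finite T] : CoalgebraStruct K (GraphAlgebra K T S) where
  comul := (comulHom K T S).toLinearMap
  counit := (counitHom K T S).toLinearMap

/-- The Connes-Kreimer algebra of Feynman graphs without edge labels. -/
abbrev CKAlgebra := GraphAlgebra K T Unit

/-- The algebra of assigned graphs, whose internal edges carry scales, with the coproduct that
extracts all two- and four-point assigned subgraphs. -/
abbrev AssignedAlgebra := GraphAlgebra K T ℕ

variable {T}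

open Classical in
/-- The sum of all assigned graphs `(G, μ)` with scales at most `ρ`. -/
noncomputable def assignedSum (ρ : ℕ) {G : FGraph T Unit} (hG : G.IsFeynman) :
    AssignedAlgebra K T :=
  ∑ μ ∈ Fintype.piFinset fun _ : G.E => Finset.Iic ρ,
    gen K (G.relabel μ) (FGraph.relabel_isFeynman hG μ)

open Classical in
theorem assignedSum_congr (ρ : ℕ) {G G' : FGraph T Unit} (hG : G.IsFeynman) (hG' : G'.IsFeynman)
    (f : G.Iso G') : assignedSum K ρ hG = assignedSum K ρ hG' := by
  refine Finset.sum_equiv (f.e.arrowCongr (Equiv.refl ℕ)) (fun μ => ?_) fun μ _ => ?_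
  · simp only [Fintype.mem_piFinset, Finset.mem_Iic]
    exact ⟨fun h x => h _, fun h x => by simpa using h (f.e x)⟩
  · exact gen_congr K _ _ (f.relabel μ)

variable (T)

/-- The morphism of algebras that sends a Feynman graph to the sum of all its scale assignments
bounded by `ρ`. -/
noncomputable def piCK (ρ : ℕ) : CKAlgebra K T →ₐ[K] AssignedAlgebra K T :=
  liftHom K (Quotient.lift (fun G => assignedSum K ρ G.2)
    fun G G' ⟨f⟩ => assignedSum_congr K ρ G.2 G'.2 f)

end Algebra

/-! ### Hopf algebras -/

/-- The axioms of a Hopf algebra for an algebra with a given coproduct and counit and a given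
antipode `S`. -/
structure IsHopfAlgebra (K A : Type*) [Field K] [CommRing A] [Algebra K A] [CoalgebraStruct K A]
    (S : A →ₗ[K] A) : Prop where
  coassoc : (TensorProduct.assoc K A A A).toLinearMap ∘ₗ
      (CoalgebraStruct.comul (R := K) (A := A)).rTensor A ∘ₗ CoalgebraStruct.comul =
    (CoalgebraStruct.comul (R := K) (A := A)).lTensor A ∘ₗ CoalgebraStruct.comul
  counit_left : (CoalgebraStruct.counit (R := K) (A := A)).rTensor A ∘ₗ CoalgebraStruct.comul =
    TensorProduct.mk K K A 1
  counit_right : (CoalgebraStruct.counit (R := K) (A := A)).lTensor A ∘ₗ CoalgebraStruct.comul =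
    (TensorProduct.mk K A K).flip 1
  counit_one : CoalgebraStruct.counit (R := K) (1 : A) = 1
  counit_mul : ∀ a b : A, CoalgebraStruct.counit (R := K) (a * b) =
    CoalgebraStruct.counit (R := K) a * CoalgebraStruct.counit (R := K) b
  comul_one : CoalgebraStruct.comul (R := K) (1 : A) = 1
  comul_mul : ∀ a b : A, CoalgebraStruct.comul (R := K) (a * b) =
    CoalgebraStruct.comul (R := K) a * CoalgebraStruct.comul (R := K) b
  antipode_left : LinearMap.mul' K A ∘ₗ S.rTensor A ∘ₗ CoalgebraStruct.comul =
    Algebra.linearMap K A ∘ₗ CoalgebraStruct.counit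
  antipode_right : LinearMap.mul' K A ∘ₗ S.lTensor A ∘ₗ CoalgebraStruct.comul =
    Algebra.linearMap K A ∘ₗ CoalgebraStruct.counit

/-! The main content is coassociativity. Apart from terms that match at once, both `(Δ ⊗ id) Δ G`
and `(id ⊗ Δ) Δ G` are sums over pairs of nested extractions `D' ⊆ D`, with summand `D' ⊗ D/D' ⊗
G/D`. In the second expression one chooses `D'` and then an extraction of the shrunk graph `G/D'`
(`quot_bijective`). In the first one chooses `D` and then, for each of its components `γ`, a term of
the coproduct of `γ`, including `γ ⊗ 1` (`restrict_bijective`). The kinds need care when `D'`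
contains all edges of a component of `D`. Seen in `G/D'`, this component is a vertex whose type was
already fixed by `D'`; seen in `D`, it is the term `γ ⊗ 1`, and `γ` keeps its residue. In both cases
the two types agree, which is the second clause of `Nested`. Both bijections are checked locally at
a vertex. The one for `G/D'` rests on `contract_isDivergentAt_iff`: shrinking 1PI pieces, but not
everything, neither creates nor destroys one particle irreducibility, and it leaves the legs
unchanged. For the antipode, every extracted component has fewer internal edges than `G`. Recursion
on this number gives a left convolution inverse of any algebra morphism to a commutative algebra.
This inverse has a left inverse too, so it is two-sided; the antipode is the inverse of the
identity. Extractions ignore scales, and a labelling of `G` bounded by `ρ` is an independent choice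
of bounded labellings of the components and of the cograph (`labellingEquiv`). Hence the sums
defining `piCK` factor and respect the coproduct. Finally `π ∘ S` and `S' ∘ π` are both convolution
inverses of `π`, hence equal. -/

namespace FGraph

variable {T S : Type}

/-! ### Connectivity of nested subgraphs -/

/-- The generated equivalence relation is the least one containing the edges; a good choice of `r`
replaces an induction along paths. -/
theorem joined_of_adj {G : FGraph T S} {F : Set G.E} (r : Setoid G.V)
    (h : ∀ e ∈ F, r.r (G.ends e false) (G.ends e true)) {v w : G.V} (hvw : (G.joined F).r v w) :
    r.r v w := by
  replace hvw : Relation.EqvGen (fun v w => ∃ e ∈ F, G.ends e false = v ∧ G.ends e true = w) v w :=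
    hvw
  induction hvw with
  | rel x y hxy =>
    obtain ⟨e, he, rfl, rfl⟩ := hxy
    exact h e he
  | refl x => exact r.iseqv.refl _
  | symm x y _ ih => exact r.iseqv.symm ih
  | trans x y z _ _ ih1 ih2 => exact r.iseqv.trans ih1 ih2

theorem joined_ends {G : FGraph T S} {F : Set G.E} {e : G.E} (he : e ∈ F) :
    (G.joined F).r (G.ends e false) (G.ends e true) :=
  Relation.EqvGen.rel _ _ ⟨e, he, rfl, rfl⟩

theorem joined_mono {G : FGraph T S} {A F : Set G.E} (h : A ⊆ F) {v w : G.V}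
    (hvw : (G.joined A).r v w) : (G.joined F).r v w :=
  joined_of_adj _ (fun _ he => joined_ends (h he)) hvw

theorem cls_eq_iff (G : FGraph T S) (F : Set G.E) (v w : G.V) :
    G.cls F v = G.cls F w ↔ (G.joined F).r v w :=
  Quotient.eq

theorem cls_mono {G : FGraph T S} {A F : Set G.E} (h : A ⊆ F) {v w : G.V}
    (hvw : G.cls A v = G.cls A w) : G.cls F v = G.cls F w :=
  (G.cls_eq_iff F v w).2 (joined_mono h ((G.cls_eq_iff A v w).1 hvw))

theorem component_joined_val {G : FGraph T S} {F : Set G.E} {c : G.Comp F} {r : Option T}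
    {A : Set (G.component F c r).E} {C : Set G.E} (h : ∀ e ∈ A, e.1 ∈ C)
    {x y : (G.component F c r).V} (hxy : ((G.component F c r).joined A).r x y) :
    (G.joined C).r x.1 y.1 :=
  joined_of_adj ((G.joined C).comap Subtype.val) (fun e he => joined_ends (h e he)) hxy

/-- A path of edges in `C ⊆ F` that starts in the component `c` never leaves it. The set `A` enters
only through membership, so that any description of it can be used. -/
theorem component_cls_eq_iff {G : FGraph T S} {F : Set G.E} {c : G.Comp F} {r : Option T}
    {C : Set G.E} (hC : C ⊆ F) {A : Set (G.component F c r).E} (hA : ∀ e, e ∈ A ↔ e.1 ∈ C)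
    (x y : (G.component F c r).V) :
    (G.component F c r).cls A x = (G.component F c r).cls A y ↔ G.cls C x.1 = G.cls C y.1 := by
  rw [cls_eq_iff, cls_eq_iff]
  refine ⟨component_joined_val fun e => (hA e).1, fun h => ?_⟩
  have key : ∀ v w, (G.joined C).r v w → ∀ (hv : G.cls F v = c) (hw : G.cls F w = c),
      ((G.component F c r).joined A).r ⟨v, hv⟩ ⟨w, hw⟩ := by
    intro v w hvw
    replace hvw :
      Relation.EqvGen (fun v w => ∃ e ∈ C, G.ends e false = v ∧ G.ends e true = w) v w := hvw
    induction hvw with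
    | rel x y hxy =>
      obtain ⟨e, he, rfl, rfl⟩ := hxy
      intro hv hw
      exact joined_ends (G := G.component F c r)
        (e := ⟨e, hC he, fun b => (G.cls_ends (hC he) b false).trans hv⟩) ((hA _).2 he)
    | refl x => exact fun _ _ => ((G.component F c r).joined A).iseqv.refl _
    | symm x y _ ih => exact fun hv hw => ((G.component F c r).joined A).iseqv.symm (ih hw hv)
    | trans x y z h1 _ ih1 ih2 =>
      intro hv hw
      have hy : G.cls F y = c := (cls_mono hC ((G.cls_eq_iff C x y).2 h1)).symm.trans hv
      exact ((G.component F c r).joined A).iseqv.trans (ih1 hv hy) (ih2 hy hw)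
  exact key x.1 y.1 h x.2 y.2

theorem joined_of_contract {G : FGraph T S} {F C : Set G.E} {κ : G.Comp F → Option T}
    {B : Set (G.contract F κ).E} (hF : ∀ v w, (G.joined F).r v w → (G.joined C).r v w)
    (hB : ∀ e ∈ B, e.1 ∈ C) {v w : G.V}
    (h : ((G.contract F κ).joined B).r (G.cls F v) (G.cls F w)) : (G.joined C).r v w := by
  -- With all representatives quantified, reflexivity is exactly `hF`, and transitivity passes
  -- through any representative of the middle class.
  let s : Setoid (G.Comp F) :=
    ⟨fun c d => ∀ v w, G.cls F v = c → G.cls F w = d → (G.joined C).r v w,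
      fun c v w hv hw => hF v w ((G.cls_eq_iff F v w).1 (hv.trans hw.symm)),
      fun h v w hv hw => (G.joined C).iseqv.symm (h w v hw hv),
      fun {c d e} h1 h2 v w hv hw => by
        obtain ⟨u, rfl⟩ := Quotient.exists_rep d
        exact (G.joined C).iseqv.trans (h1 v u hv rfl) (h2 u w rfl hw)⟩
  refine joined_of_adj (G := G.contract F κ) s (fun e he v w hv hw => ?_) h v w rfl rfl
  have h1 := hF _ _ ((G.cls_eq_iff F _ _).1 hv)
  have h2 := hF _ _ ((G.cls_eq_iff F _ _).1 hw)
  exact (G.joined C).iseqv.trans h1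
    ((G.joined C).iseqv.trans (joined_ends (hB e he)) ((G.joined C).iseqv.symm h2))

theorem contract_cls_eq_iff {G : FGraph T S} {A F : Set G.E} (hAF : A ⊆ F)
    {κ : G.Comp A → Option T} {B : Set (G.contract A κ).E} (hB : ∀ e, e ∈ B ↔ e.1 ∈ F)
    (v w : G.V) :
    (G.contract A κ).cls B (G.cls A v) = (G.contract A κ).cls B (G.cls A w) ↔
      G.cls F v = G.cls F w := by
  refine ((G.contract A κ).cls_eq_iff B _ _).trans (Iff.trans ?_ (G.cls_eq_iff F v w).symm)
  exact ⟨joined_of_contract (fun _ _ => joined_mono hAF) fun e => (hB e).1,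
    G.contract_joined A κ fun e he h => (hB ⟨e, h⟩).2 he⟩

/-- A graph is one particle irreducible if it becomes so by shrinking one particle irreducible
subgraphs. -/
theorem isOnePI_of_contract {G : FGraph T S} {F : Set G.E} {κ : G.Comp F → Option T}
    (hF : ∀ c, G.Nontrivial F c → (G.component F c (κ c)).IsOnePI)
    (h : (G.contract F κ).IsOnePI) : G.IsOnePI := by
  have conn : ∀ (C : Set G.E) (B : Set (G.contract F κ).E),
      (∀ v w, (G.joined F).r v w → (G.joined C).r v w) → (∀ e ∈ B, e.1 ∈ C) →
      (G.contract F κ).ConnectedOn B → G.ConnectedOn C := by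
    intro C B h1 h2 h3
    obtain ⟨⟨c⟩, h4⟩ := h3
    obtain ⟨v, -⟩ := Quotient.exists_rep c
    exact ⟨⟨v⟩, fun v w => joined_of_contract h1 h2 (h4 _ _)⟩
  refine ⟨h.1.map Subtype.val, conn _ _ (fun _ _ => joined_mono (Set.subset_univ _))
    (fun _ _ => trivial) h.2.1, fun e => ?_⟩
  -- If the cut edge lies in `F`, its component stays connected without it, so no connection through
  -- `F` is lost and the shrunk graph is used uncut. Otherwise the cut is made in the shrunk graph.
  by_cases he : e ∈ F
  · refine conn _ Set.univ (fun v w hvw => joined_of_adj _ (fun e' he' => ?_) hvw)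
      (fun x _ hx => ?_) h.2.1
    · by_cases hee : e' = e
      · subst hee
        have h5 := (hF (G.cls F (G.ends e' false)) ⟨e', he, false, rfl⟩).2.2
          ⟨e', he, fun b => G.cls_ends he b false⟩
        refine component_joined_val (C := {e'}ᶜ) ?_
          (h5.2 ⟨G.ends e' false, rfl⟩ ⟨G.ends e' true, G.cls_ends he true false⟩)
        exact fun x hx hx' => hx (Subtype.ext hx')
      · exact joined_ends hee
    · exact x.2 (by rw [show x.1 = e from hx]; exact he)
  · refine conn {e}ᶜ _ (fun v w => joined_mono ?_) ?_ (h.2.2 ⟨e, he⟩)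
    · rintro x hx rfl
      exact he hx
    · exact fun x hx hxe => hx (Subtype.ext hxe)

theorem contract_isOnePI {G : FGraph T S} {F : Set G.E} (κ : G.Comp F → Option T)
    (hF : F ≠ Set.univ) (h : G.IsOnePI) : (G.contract F κ).IsOnePI := by
  refine ⟨?_, G.contract_connectedOn F κ (fun _ _ _ => trivial) h.2.1, fun e => ?_⟩
  · obtain ⟨e, he⟩ := (Set.ne_univ_iff_exists_notMem F).1 hF
    exact ⟨⟨e, he⟩⟩
  · refine G.contract_connectedOn F κ ?_ (h.2.2 e.1)
    exact fun x hx hxF hxe => hx (congrArg Subtype.val hxe)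

/-! ### Isomorphisms between nested components and contractions -/

/-- The legs of a component of a component. -/
noncomputable def componentComponentLegs (G : FGraph T S) {F : Set G.E} {c : G.Comp F} {r r' : Option T}
    {C : Set G.E} (hC : C ⊆ F) {A : Set (G.component F c r).E} (hA : ∀ e, e ∈ A ↔ e.1 ∈ C)
    (v : (G.component F c r).V) :
    ((G.component F c r).component A ((G.component F c r).cls A v) r').L ≃
      (G.component C (G.cls C v.1) r').L where
  toFun
    | Sum.inl p => Sum.inl ⟨(p.1.1.1, p.1.2), fun h => p.2.1 ((hA _).2 h),
        (component_cls_eq_iff hC hA _ _).1 p.2.2⟩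
    | Sum.inr ⟨Sum.inl p, h⟩ => Sum.inl ⟨p.1, fun h' => p.2.1 (hC h'),
        (component_cls_eq_iff hC hA _ _).1 h⟩
    | Sum.inr ⟨Sum.inr l, h⟩ => Sum.inr ⟨l.1, (component_cls_eq_iff hC hA _ _).1 h⟩
  invFun := open Classical in fun
    | Sum.inl p =>
      have hc : G.cls F (G.ends p.1.1 p.1.2) = c := (cls_mono hC p.2.2).trans v.2
      -- A half-edge outside `C` is half of an internal edge of the larger component if its edge
      -- lies in `F`; otherwise it is already a leg there.
      if h : p.1.1 ∈ F then
        Sum.inl ⟨(⟨p.1.1, h, fun b => (G.cls_ends h b p.1.2).trans hc⟩, p.1.2),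
          fun h' => p.2.1 ((hA _).1 h'), (component_cls_eq_iff hC hA _ _).2 p.2.2⟩
      else Sum.inr ⟨Sum.inl ⟨p.1, h, hc⟩, (component_cls_eq_iff hC hA _ _).2 p.2.2⟩
    | Sum.inr l => Sum.inr ⟨Sum.inr ⟨l.1, (cls_mono hC l.2).trans v.2⟩,
        (component_cls_eq_iff hC hA _ _).2 l.2⟩
  left_inv := by
    rintro (⟨⟨⟨e, he⟩, b⟩, h⟩ | ⟨⟨⟨e, b⟩, he⟩ | ⟨l, hl⟩, h⟩)
    · exact dif_pos he.1
    · exact dif_neg he.1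
    · rfl
  right_inv := by
    rintro (⟨⟨e, b⟩, h⟩ | ⟨l, h⟩)
    · by_cases he : e ∈ F <;> simp [he] <;> rfl
    · rfl

/-- A component of a component is a component of the graph. -/
noncomputable def componentComponent (G : FGraph T S) {F : Set G.E} {c : G.Comp F} {r : Option T}
    {C : Set G.E} (hC : C ⊆ F) {A : Set (G.component F c r).E} (hA : ∀ e, e ∈ A ↔ e.1 ∈ C)
    (v : (G.component F c r).V) (r' : Option T) :
    ((G.component F c r).component A ((G.component F c r).cls A v) r').Iso
      (G.component C (G.cls C v.1) r') where
  v :=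
    { toFun := fun w => ⟨w.1.1, (component_cls_eq_iff hC hA _ _).1 w.2⟩
      invFun := fun w => ⟨⟨w.1, (cls_mono hC w.2).trans v.2⟩,
        (component_cls_eq_iff hC hA _ _).2 w.2⟩
      left_inv := fun _ => rfl
      right_inv := fun _ => rfl }
  e :=
    { toFun := fun e => ⟨e.1.1, (hA _).1 e.2.1,
        fun b => (component_cls_eq_iff hC hA _ _).1 (e.2.2 b)⟩
      invFun := fun e => ⟨⟨e.1, hC e.2.1, fun b => (cls_mono hC (e.2.2 b)).trans v.2⟩,
        (hA _).2 e.2.1, fun b => (component_cls_eq_iff hC hA _ _).2 (e.2.2 b)⟩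
      left_inv := fun _ => rfl
      right_inv := fun _ => rfl }
  l := G.componentComponentLegs hC hA v
  ends := fun _ => Or.inl fun _ => rfl
  att := by
    rintro (⟨⟨⟨e, he⟩, b⟩, h⟩ | ⟨⟨⟨e, b⟩, he⟩ | ⟨l, hl⟩, h⟩) <;> rfl
  kind := fun _ => rfl
  res := rfl
  lab := fun _ => rfl

/-- The components of a subgraph, as vertices of the graph obtained by shrinking its components. -/
noncomputable def contractComp (G : FGraph T S) {A F : Set G.E} (hAF : A ⊆ F)
    (κ : G.Comp A → Option T) {B : Set (G.contract A κ).E} (hB : ∀ e, e ∈ B ↔ e.1 ∈ F) :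
    G.Comp F ≃ (G.contract A κ).Comp B :=
  Equiv.ofBijective
    (Quotient.lift (fun v => (G.contract A κ).cls B (G.cls A v)) fun v w h =>
      (contract_cls_eq_iff hAF hB v w).2 ((G.cls_eq_iff F v w).2 h))
    ⟨fun c d => by
      induction c using Quotient.inductionOn
      induction d using Quotient.inductionOn
      exact (contract_cls_eq_iff hAF hB _ _).1,
    fun c => by
      obtain ⟨d, rfl⟩ := Quotient.exists_rep c
      obtain ⟨v, rfl⟩ := Quotient.exists_rep d
      exact ⟨G.cls F v, rfl⟩⟩

/-- Shrinking in two steps. -/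
noncomputable def contractContract (G : FGraph T S) {A F : Set G.E} (hAF : A ⊆ F)
    (κ : G.Comp A → Option T) {B : Set (G.contract A κ).E} (hB : ∀ e, e ∈ B ↔ e.1 ∈ F)
    (κB : (G.contract A κ).Comp B → Option T) (κF : G.Comp F → Option T)
    (hκ : ∀ v, κB ((G.contract A κ).cls B (G.cls A v)) = κF (G.cls F v)) :
    (G.contract F κF).Iso ((G.contract A κ).contract B κB) where
  v := G.contractComp hAF κ hB
  e :=
    { toFun := fun e => ⟨⟨e.1, fun h => e.2 (hAF h)⟩, fun h => e.2 ((hB _).1 h)⟩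
      invFun := fun e => ⟨e.1.1, fun h => e.2 ((hB _).2 h)⟩
      left_inv := fun _ => rfl
      right_inv := fun _ => rfl }
  l := Equiv.refl _
  ends := fun _ => Or.inl fun _ => rfl
  att := fun _ => rfl
  kind := fun c => by
    induction c using Quotient.inductionOn
    exact hκ _
  res := rfl
  lab := fun _ => rfl

/-- Shrinking a subgraph of a component gives a component of the graph with the subgraph shrunk. -/
noncomputable def componentContract (G : FGraph T S) {A F : Set G.E} (hAF : A ⊆ F)
    (κ : G.Comp A → Option T) {B : Set (G.contract A κ).E} (hB : ∀ e, e ∈ B ↔ e.1 ∈ F)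
    (v : G.V) (r : Option T) {C : Set (G.component F (G.cls F v) r).E}
    (hC : ∀ e, e ∈ C ↔ e.1 ∈ A) (κC : (G.component F (G.cls F v) r).Comp C → Option T)
    (hκ : ∀ x, κC ((G.component F (G.cls F v) r).cls C x) = κ (G.cls A x.1)) :
    ((G.component F (G.cls F v) r).contract C κC).Iso
      ((G.contract A κ).component B ((G.contract A κ).cls B (G.cls A v)) r) where
  v := Equiv.ofBijective
    (Quotient.lift (fun x => ⟨G.cls A x.1, (contract_cls_eq_iff hAF hB _ _).2 x.2⟩) fun x y h =>
      Subtype.ext ((component_cls_eq_iff hAF hC x y).1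
        (((G.component F (G.cls F v) r).cls_eq_iff C x y).2 h)))
    ⟨fun c d => by
      induction c using Quotient.inductionOn
      induction d using Quotient.inductionOn
      exact fun h => (component_cls_eq_iff hAF hC _ _).2 (congrArg Subtype.val h),
    fun ⟨c, hc⟩ => by
      obtain ⟨w, rfl⟩ := Quotient.exists_rep c
      exact ⟨(G.component F (G.cls F v) r).cls C ⟨w, (contract_cls_eq_iff hAF hB _ _).1 hc⟩, rfl⟩⟩
  e :=
    { toFun := fun e => ⟨⟨e.1.1, fun h => e.2 ((hC _).2 h)⟩, (hB _).2 e.1.2.1,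
        fun b => (contract_cls_eq_iff hAF hB _ _).2 (e.1.2.2 b)⟩
      invFun := fun e => ⟨⟨e.1.1, (hB _).1 e.2.1,
        fun b => (contract_cls_eq_iff hAF hB _ _).1 (e.2.2 b)⟩, fun h => e.1.2 ((hC _).1 h)⟩
      left_inv := fun _ => rfl
      right_inv := fun _ => rfl }
  l := Equiv.sumCongr
    { toFun := fun p => ⟨(⟨p.1.1, fun h => p.2.1 (hAF h)⟩, p.1.2), fun h => p.2.1 ((hB _).1 h),
        (contract_cls_eq_iff hAF hB _ _).2 p.2.2⟩
      invFun := fun p => ⟨(p.1.1.1, p.1.2), fun h => p.2.1 ((hB _).2 h),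
        (contract_cls_eq_iff hAF hB _ _).1 p.2.2⟩
      left_inv := fun _ => rfl
      right_inv := fun _ => rfl }
    (Equiv.subtypeEquivRight fun l => (contract_cls_eq_iff hAF hB _ _).symm)
  ends := fun _ => Or.inl fun _ => rfl
  att := by rintro (⟨⟨e, b⟩, h⟩ | ⟨l, h⟩) <;> rfl
  kind := fun c => by
    induction c using Quotient.inductionOn
    exact (hκ _).symm
  res := rfl
  lab := fun _ => rfl

/-! ### Divergent subgraphs, locally at a vertex -/

/-- The component of `v` in the subgraph with edge set `F` is a single vertex of type `r`, or it is
one particle irreducible with two or four legs and may be replaced by a vertex of type `r`. -/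
structure IsDivergentAt (G : FGraph T S) (F : Set G.E) (r : Option T) (v : G.V) : Prop where
  onePI : G.Nontrivial F (G.cls F v) → (G.component F (G.cls F v) r).IsOnePI
  legs : G.Nontrivial F (G.cls F v) → (G.component F (G.cls F v) r).legs = 2 ∨
    (G.component F (G.cls F v) r).legs = 4
  kind_iff : G.Nontrivial F (G.cls F v) →
    ((G.component F (G.cls F v) r).legs = 2 ↔ r.isSome)
  kind_eq : ¬ G.Nontrivial F (G.cls F v) → r = G.kind v

/-- Conditions on components become conditions at vertices, so that iterated quotients can be
handled through representatives. -/
theorem isExtraction_iff {G : FGraph T S} {F : Set G.E} {κ : G.Comp F → Option T} :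
    G.IsExtraction F κ ↔ F ≠ Set.univ ∧ ∀ v, G.IsDivergentAt F (κ (G.cls F v)) v := by
  refine ⟨fun h => ⟨h.proper, fun v => ⟨h.onePI _, h.legs _, h.kind_iff _, h.kind_eq v⟩⟩,
    fun h => ⟨h.1, fun c => ?_, fun c => ?_, fun c => ?_, fun v => (h.2 v).kind_eq⟩⟩ <;>
  induction c using Quotient.inductionOn
  exacts [(h.2 _).onePI, (h.2 _).legs, (h.2 _).kind_iff]

/-- Divergence sees only the isomorphism type of the component and, if this is a single vertex, the
type of the vertex. -/
theorem isDivergentAt_congr {G G' : FGraph T S} {F : Set G.E} {F' : Set G'.E} {r : Option T}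
    {v : G.V} {v' : G'.V} (hk : G.kind v = G'.kind v')
    (f : (G.component F (G.cls F v) r).Iso (G'.component F' (G'.cls F' v') r)) :
    G.IsDivergentAt F r v ↔ G'.IsDivergentAt F' r v' := by
  have hn : G.Nontrivial F (G.cls F v) ↔ G'.Nontrivial F' (G'.cls F' v') :=
    (G.nontrivial_iff _ _ r).trans (f.e.nonempty_congr.trans (G'.nontrivial_iff _ _ r).symm)
  constructor
  · intro h
    refine ⟨fun h' => f.isOnePI (h.onePI (hn.2 h')), fun h' => ?_, fun h' => ?_,
      fun h' => (h.kind_eq (hn.not.2 h')).trans hk⟩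
    · rw [f.legs_eq]; exact h.legs (hn.2 h')
    · rw [f.legs_eq]; exact h.kind_iff (hn.2 h')
  · intro h
    refine ⟨fun h' => f.symm.isOnePI (h.onePI (hn.1 h')), fun h' => ?_, fun h' => ?_,
      fun h' => (h.kind_eq (hn.not.1 h')).trans hk.symm⟩
    · rw [← f.legs_eq]; exact h.legs (hn.1 h')
    · rw [← f.legs_eq]; exact h.kind_iff (hn.1 h')

theorem component_isDivergentAt_iff {G : FGraph T S} {F : Set G.E} {c : G.Comp F} {r : Option T}
    {C : Set G.E} (hC : C ⊆ F) {A : Set (G.component F c r).E} (hA : ∀ e, e ∈ A ↔ e.1 ∈ C)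
    (v : (G.component F c r).V) (r' : Option T) :
    (G.component F c r).IsDivergentAt A r' v ↔ G.IsDivergentAt C r' v.1 :=
  isDivergentAt_congr rfl (G.componentComponent hC hA v r')

/-- A connected graph is its only component. -/
noncomputable def componentUniv (G : FGraph T S) (h : ∀ v w, (G.joined Set.univ).r v w)
    (c : G.Comp Set.univ) : (G.component Set.univ c G.res).Iso G :=
  have hc : ∀ w, G.cls Set.univ w = c := by
    induction c using Quotient.inductionOn
    exact fun w => (G.cls_eq_iff _ _ _).2 (h _ _)
  { v := Equiv.subtypeUnivEquiv hc
    e := Equiv.subtypeUnivEquiv fun _ => ⟨trivial, fun _ => hc _⟩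
    l := (Equiv.sumCongr (@Equiv.equivEmpty _ ⟨fun p => p.2.1 trivial⟩)
      (Equiv.subtypeUnivEquiv fun _ => hc _)).trans (Equiv.emptySum _ _)
    ends := fun _ => Or.inl fun _ => rfl
    att := by
      rintro (p | l)
      · exact (p.2.1 trivial).elim
      · rfl
    kind := fun _ => rfl
    res := rfl
    lab := fun _ => rfl }

theorem mem_of_eq_univ {α : Type*} {s : Set α} (h : s = Set.univ) (a : α) : a ∈ s := h ▸ trivial

theorem component_joined_univ (G : FGraph T S) (F : Set G.E) (c : G.Comp F) (r : Option T)
    (v w : (G.component F c r).V) : ((G.component F c r).joined Set.univ).r v w := by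
  rw [← cls_eq_iff]
  exact (component_cls_eq_iff (A := Set.univ) subset_rfl (fun e => iff_of_true trivial e.2.1)
    v w).2 (v.2.trans w.2.symm)

/-- The component of `F` is connected, hence its own only component; as all its edges lie in `A`, it
is also a component of `A`. -/
theorem isDivergentAt_iff_of_forall_mem {G : FGraph T S} {A F : Set G.E} (hAF : A ⊆ F) {v : G.V}
    (h : ∀ e ∈ F, G.cls F (G.ends e false) = G.cls F v → e ∈ A) (r : Option T) :
    G.IsDivergentAt F r v ↔ G.IsDivergentAt A r v := by
  have hu : ∀ e : (G.component F (G.cls F v) r).E, e ∈ Set.univ ↔ e.1 ∈ A :=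
    fun e => iff_of_true trivial (h e.1 e.2.1 (e.2.2 false))
  exact isDivergentAt_congr rfl
    (((G.component F (G.cls F v) r).componentUniv (G.component_joined_univ F _ r)
      (Quotient.mk _ ⟨v, rfl⟩)).symm.trans (G.componentComponent hAF hu ⟨v, rfl⟩ r))

theorem nontrivial_iff_ends (G : FGraph T S) (F : Set G.E) (c : G.Comp F) :
    G.Nontrivial F c ↔ ∃ e ∈ F, G.cls F (G.ends e false) = c :=
  ⟨fun ⟨e, he, b, hb⟩ => ⟨e, he, (G.cls_ends he _ b).trans hb⟩,
    fun ⟨e, he, h⟩ => ⟨e, he, false, h⟩⟩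

theorem contract_nontrivial_iff {G : FGraph T S} {A F : Set G.E} (hAF : A ⊆ F)
    {κ : G.Comp A → Option T} {B : Set (G.contract A κ).E} (hB : ∀ e, e ∈ B ↔ e.1 ∈ F) (v : G.V) :
    (G.contract A κ).Nontrivial B ((G.contract A κ).cls B (G.cls A v)) ↔
      ∃ e ∈ F, G.cls F (G.ends e false) = G.cls F v ∧ e ∉ A := by
  rw [nontrivial_iff_ends]
  constructor
  · rintro ⟨e, he, h⟩
    exact ⟨e.1, (hB e).1 he, (contract_cls_eq_iff hAF hB _ _).1 h, e.2⟩
  · rintro ⟨e, he, h, heA⟩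
    exact ⟨⟨e, heA⟩, (hB _).2 he, (contract_cls_eq_iff hAF hB _ _).2 h⟩

/-- If the component of `F` has an edge outside `A`, the component of `B` arises from it by
shrinking 1PI pieces, so the legs agree and irreducibility passes both ways. Otherwise it has become
a single vertex of type `κ`, and `kind_eq` forces `r` to be this type; hence the last conjunct. -/
theorem contract_isDivergentAt_iff {G : FGraph T S} {A F : Set G.E} (hAF : A ⊆ F)
    {κ : G.Comp A → Option T} (hA : ∀ v, G.IsDivergentAt A (κ (G.cls A v)) v)
    {B : Set (G.contract A κ).E} (hB : ∀ e, e ∈ B ↔ e.1 ∈ F) (v : G.V) (r : Option T) :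
    (G.contract A κ).IsDivergentAt B r (G.cls A v) ↔ G.IsDivergentAt F r v ∧
      ((∀ e ∈ F, G.cls F (G.ends e false) = G.cls F v → e ∈ A) → r = κ (G.cls A v)) := by
  have hn := contract_nontrivial_iff hAF hB v
  by_cases h : ∃ e ∈ F, G.cls F (G.ends e false) = G.cls F v ∧ e ∉ A
  · have hF : G.Nontrivial F (G.cls F v) := by
      obtain ⟨e, he, h1, -⟩ := h
      exact ⟨e, he, false, h1⟩
    -- The trace of `A` on the component of `F`, with the inherited types; shrinking it yields the
    -- component of `B`.
    let C : Set (G.component F (G.cls F v) r).E := {e | e.1 ∈ A}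
    let κC : (G.component F (G.cls F v) r).Comp C → Option T :=
      Quotient.lift (fun x => κ (G.cls A x.1)) fun x y hxy => congrArg κ
        ((component_cls_eq_iff hAF (fun _ => Iff.rfl) x y).1 ((cls_eq_iff _ C x y).2 hxy))
    have f := G.componentContract hAF κ hB v r (C := C) (fun _ => Iff.rfl) κC fun _ => rfl
    have hC : C ≠ Set.univ := by
      obtain ⟨e, he, h1, h2⟩ := h
      exact fun hC => h2 ((hC ▸ trivial :
        (⟨e, he, fun b => (G.cls_ends he b false).trans h1⟩ : (G.component F _ r).E) ∈ C))
    have hl : ((G.contract A κ).component B ((G.contract A κ).cls B (G.cls A v)) r).legs =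
      (G.component F (G.cls F v) r).legs := f.legs_eq
    have h1 : ((G.contract A κ).component B ((G.contract A κ).cls B (G.cls A v)) r).IsOnePI ↔
        (G.component F (G.cls F v) r).IsOnePI := by
      refine ⟨fun h1 => isOnePI_of_contract (fun c hc => ?_) (f.symm.isOnePI h1),
        fun h1 => f.isOnePI (contract_isOnePI κC hC h1)⟩
      induction c using Quotient.inductionOn with
      | h x => exact ((component_isDivergentAt_iff hAF (fun _ => Iff.rfl) x _).2 (hA x.1)).onePI hc
    constructor
    · intro h2
      have h3 := hn.2 h
      refine ⟨⟨fun _ => h1.1 (h2.onePI h3), fun _ => hl ▸ h2.legs h3,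
        fun _ => hl ▸ h2.kind_iff h3, fun h4 => absurd hF h4⟩, fun h4 => ?_⟩
      obtain ⟨e, he, h5, h6⟩ := h
      exact absurd (h4 e he h5) h6
    · rintro ⟨h2, -⟩
      exact ⟨fun _ => h1.2 (h2.onePI hF), fun _ => hl ▸ h2.legs hF,
        fun _ => hl ▸ h2.kind_iff hF, fun h4 => absurd (hn.2 h) h4⟩
  · have h' := h
    push Not at h'
    rw [← hn] at h
    constructor
    · intro h2
      have h3 : r = κ (G.cls A v) := h2.kind_eq h
      refine ⟨?_, fun _ => h3⟩
      rw [isDivergentAt_iff_of_forall_mem hAF h', h3]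
      exact hA v
    · rintro ⟨-, h2⟩
      exact ⟨fun h3 => absurd h3 h, fun h3 => absurd h3 h, fun h3 => absurd h3 h,
        fun _ => h2 h'⟩

/-! ### Nested extractions -/

namespace Extraction

variable {G : FGraph T S}

/-- The type of the vertex that replaces the component of `v`. -/
def kindAt (D : G.Extraction) (v : G.V) : Option T := D.1.2 (G.cls D.1.1 v)

theorem isDivergentAt (D : G.Extraction) (v : G.V) : G.IsDivergentAt D.1.1 (D.kindAt v) v :=
  (isExtraction_iff.1 D.2).2 v

theorem ext_kindAt {D D' : G.Extraction} (h : D.1.1 = D'.1.1)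
    (hκ : ∀ v, D.kindAt v = D'.kindAt v) : D = D' :=
  extraction_ext h hκ

theorem kindAt_congr (D : G.Extraction) {v w : G.V} (h : G.cls D.1.1 v = G.cls D.1.1 w) :
    D.kindAt v = D.kindAt w :=
  congrArg D.1.2 h

/-- The subgraph of `D'` is contained in that of `D`, and the components of `D` that are contained
in the subgraph of `D'` are replaced by the same vertices. -/
def Nested (D' D : G.Extraction) : Prop :=
  D'.1.1 ⊆ D.1.1 ∧ ∀ v, (∀ e ∈ D.1.1, G.cls D.1.1 (G.ends e false) = G.cls D.1.1 v → e ∈ D'.1.1) →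
    D.kindAt v = D'.kindAt v

/-- The edges of a larger extraction that remain when a nested extraction is shrunk. -/
def quotEdges (D' D : G.Extraction) : Set (G.contract D'.1.1 D'.1.2).E := {e | e.1 ∈ D.1.1}

/-- The components of a larger extraction, when a nested extraction is shrunk. -/
noncomputable def quotComp (D' D : G.Extraction) (h : D'.Nested D) :
    G.Comp D.1.1 ≃ (G.contract D'.1.1 D'.1.2).Comp (D'.quotEdges D) :=
  G.contractComp h.1 D'.1.2 fun _ => Iff.rfl

theorem quot_isDivergentAt (D' D : G.Extraction) (h : D'.Nested D) (v : G.V) :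
    (G.contract D'.1.1 D'.1.2).IsDivergentAt (D'.quotEdges D) (D.kindAt v) (G.cls D'.1.1 v) :=
  (contract_isDivergentAt_iff h.1 D'.isDivergentAt (fun _ => Iff.rfl) v _).2
    ⟨D.isDivergentAt v, h.2 v⟩

/-- The extraction induced on the graph in which a nested extraction is shrunk. -/
noncomputable def quot (D' D : G.Extraction) (h : D'.Nested D) :
    (G.contract D'.1.1 D'.1.2).Extraction :=
  ⟨⟨D'.quotEdges D, D.1.2 ∘ (D'.quotComp D h).symm⟩, by
    refine isExtraction_iff.2 ⟨fun h1 => ?_, fun c => ?_⟩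
    · refine D.2.proper (Set.eq_univ_of_forall fun e => ?_)
      by_cases he : e ∈ D'.1.1
      · exact h.1 he
      · exact (mem_of_eq_univ h1 ⟨e, he⟩ :)
    · induction c using Quotient.inductionOn with
      | h v =>
        have h1 : D.1.2 ((D'.quotComp D h).symm
            ((G.contract D'.1.1 D'.1.2).cls (D'.quotEdges D) (G.cls D'.1.1 v))) = D.kindAt v :=
          congrArg D.1.2 ((D'.quotComp D h).symm_apply_apply (G.cls D.1.1 v))
        exact h1.symm ▸ D'.quot_isDivergentAt D h v⟩

theorem quot_kindAt (D' D : G.Extraction) (h : D'.Nested D) (v : G.V) :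
    (D'.quot D h).kindAt (G.cls D'.1.1 v) = D.kindAt v :=
  congrArg D.1.2 ((D'.quotComp D h).symm_apply_apply (G.cls D.1.1 v))

/-- The inverse adds the edges of `D'` back to those of an extraction of the shrunk graph. By
`contract_isDivergentAt_iff`, divergence in the shrunk graph is divergence of the union together
with the condition on kinds in `Nested`. -/
theorem quot_bijective (D' : G.Extraction) :
    Function.Bijective fun D : {D : G.Extraction // D'.Nested D} => D'.quot D.1 D.2 := by
  constructor
  · rintro ⟨D, hD⟩ ⟨E, hE⟩ h
    have h : D'.quot D hD = D'.quot E hE := h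
    refine Subtype.ext (ext_kindAt (Set.ext fun e => ?_) fun v => ?_)
    · by_cases he : e ∈ D'.1.1
      · exact iff_of_true (hD.1 he) (hE.1 he)
      · have h1 : (D'.quot D hD).1.1 = (D'.quot E hE).1.1 := by rw [h]
        exact (Set.ext_iff.1 h1 ⟨e, he⟩ :)
    · rw [← quot_kindAt D' D hD, ← quot_kindAt D' E hE, h]
  · intro E
    let F : Set G.E := D'.1.1 ∪ Subtype.val '' E.1.1
    have hF : D'.1.1 ⊆ F := Set.subset_union_left
    have hE : ∀ e : (G.contract D'.1.1 D'.1.2).E, e ∈ E.1.1 ↔ e.1 ∈ F := by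
      intro e
      refine ⟨fun h => Or.inr ⟨e, h, rfl⟩, ?_⟩
      rintro (h | ⟨e', h, h'⟩)
      · exact absurd h e.2
      · exact Subtype.ext h' ▸ h
    have h1 : ∀ v, _ := fun v => (contract_isDivergentAt_iff hF D'.isDivergentAt hE v _).1
      (E.isDivergentAt (G.cls D'.1.1 v))
    let D : G.Extraction := ⟨⟨F, E.1.2 ∘ G.contractComp hF D'.1.2 hE⟩, isExtraction_iff.2
      ⟨fun h2 => E.2.proper (Set.eq_univ_of_forall fun e => (hE e).2 (mem_of_eq_univ h2 e.1)),
        fun v => (h1 v).1⟩⟩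
    have hD : D'.Nested D := ⟨hF, fun v => (h1 v).2⟩
    refine ⟨⟨D, hD⟩, ext_kindAt (Set.ext fun e => (hE e).symm) fun c => ?_⟩
    obtain ⟨v, rfl⟩ := Quotient.exists_rep c
    exact quot_kindAt D' D hD v

end Extraction

/-! ### Families of extractions in the components of a larger extraction -/

/-- An extraction that is allowed to consist of the whole graph, which is then replaced by a vertex
of its own type. -/
def FullExtraction (G : FGraph T S) : Type :=
  {D : (Σ F : Set G.E, (G.Comp F → Option T)) //
    (∀ v, G.IsDivergentAt D.1 (D.2 (G.cls D.1 v)) v) ∧ (D.1 = Set.univ → ∀ c, D.2 c = G.res)}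

namespace FullExtraction

variable {G : FGraph T S}

/-- The type of the vertex that replaces the component of `v`. -/
def kindAt (D : G.FullExtraction) (v : G.V) : Option T := D.1.2 (G.cls D.1.1 v)

theorem ext_kindAt {D D' : G.FullExtraction} (h : D.1.1 = D'.1.1)
    (hκ : ∀ v, D.kindAt v = D'.kindAt v) : D = D' := by
  obtain ⟨⟨F, κ⟩, hD⟩ := D
  obtain ⟨⟨F', κ'⟩, hD'⟩ := D'
  obtain rfl : F = F' := h
  obtain rfl : κ = κ' := funext fun c => Quotient.inductionOn c hκ
  rfl

end FullExtraction

namespace Extraction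

variable {G : FGraph T S}

/-- The restriction of a nested extraction to a component. -/
def restrict (D' D : G.Extraction) (h : D'.Nested D) (c : G.Comp D.1.1) :
    (G.component D.1.1 c (D.1.2 c)).FullExtraction :=
  ⟨⟨{e | e.1 ∈ D'.1.1}, Quotient.lift (fun x => D'.kindAt x.1) fun x y hxy => D'.kindAt_congr
      ((component_cls_eq_iff h.1 (fun _ => Iff.rfl) x y).1 ((cls_eq_iff _ _ x y).2 hxy))⟩,
    fun x => (component_isDivergentAt_iff h.1 (fun _ => Iff.rfl) x _).2 (D'.isDivergentAt x.1),
    -- Here the smaller extraction contains the whole component, so nestedness makes the types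
    -- agree.
    fun h1 d => by
      induction d using Quotient.inductionOn with
      | h x =>
        refine (h.2 x.1 fun e he h2 => ?_).symm.trans (congrArg D.1.2 x.2)
        exact (mem_of_eq_univ h1
          ⟨e, he, fun b => (G.cls_ends he b false).trans (h2.trans x.2)⟩ :)⟩

theorem nontrivial_mono {A F : Set G.E} (h : A ⊆ F) {v : G.V} (hv : G.Nontrivial A (G.cls A v)) :
    G.Nontrivial F (G.cls F v) := by
  obtain ⟨e, he, b, hb⟩ := hv
  exact ⟨e, h he, b, cls_mono h hb⟩

/-- Each edge of `D` lies in exactly one component, so edge sets chosen in the components can be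
united and recovered from the union. Vertices outside `D` leave no choice of type. -/
theorem restrict_bijective (D : G.Extraction) :
    Function.Bijective fun (D' : {D' : G.Extraction // D'.Nested D})
      (c : {c : G.Comp D.1.1 // G.Nontrivial D.1.1 c}) => D'.1.restrict D D'.2 c.1 := by
  constructor
  · rintro ⟨A, hA⟩ ⟨B, hB⟩ h
    have h : ∀ c, G.Nontrivial D.1.1 c → A.restrict D hA c = B.restrict D hB c :=
      fun c hc => congrFun h ⟨c, hc⟩
    refine Subtype.ext (ext_kindAt (Set.ext fun e => ?_) fun v => ?_)
    · by_cases he : e ∈ D.1.1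
      · have h1 := congrArg (fun E => E.1.1) (h (G.cls _ (G.ends e false)) ⟨e, he, false, rfl⟩)
        exact (Set.ext_iff.1 h1 ⟨e, he, fun b => G.cls_ends he b false⟩ :)
      · exact iff_of_false (fun h1 => he (hA.1 h1)) fun h1 => he (hB.1 h1)
    · by_cases hv : G.Nontrivial D.1.1 (G.cls D.1.1 v)
      · exact congrArg (fun E => E.kindAt ⟨v, rfl⟩) (h _ hv)
      · exact ((A.isDivergentAt v).kind_eq fun h1 => hv (nontrivial_mono hA.1 h1)).trans
          ((B.isDivergentAt v).kind_eq fun h1 => hv (nontrivial_mono hB.1 h1)).symm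
  · intro p
    let A : Set G.E := {e | ∃ c, ∃ x ∈ (p c).1.1, x.1 = e}
    have hA : A ⊆ D.1.1 := by
      rintro e ⟨c, x, -, rfl⟩
      exact x.2.1
    have hp : ∀ c, ∀ x : (G.component D.1.1 c.1 (D.1.2 c.1)).E, x ∈ (p c).1.1 ↔ x.1 ∈ A := by
      intro c x
      refine ⟨fun hx => ⟨c, x, hx, rfl⟩, ?_⟩
      rintro ⟨c', x', hx', h⟩
      -- An edge belongs to one component only, so the other members of the family add nothing
      -- inside `c`.
      obtain rfl : c' = c := Subtype.ext ((x'.2.2 false).symm.trans (h ▸ x.2.2 false))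
      exact Subtype.ext h ▸ hx'
    classical
    let k : G.V → Option T := fun v => if h : G.Nontrivial D.1.1 (G.cls D.1.1 v) then
      (p ⟨_, h⟩).kindAt ⟨v, rfl⟩ else G.kind v
    have hk : ∀ c, ∀ x : (G.component D.1.1 c.1 (D.1.2 c.1)).V, k x.1 = (p c).kindAt x := by
      rintro ⟨c, hc⟩ ⟨v, hv⟩
      have hv : G.cls D.1.1 v = c := hv
      subst hv
      exact dif_pos hc
    have hd : ∀ v, G.IsDivergentAt A (k v) v := by
      intro v
      by_cases hv : G.Nontrivial D.1.1 (G.cls D.1.1 v)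
      · have h1 := (component_isDivergentAt_iff hA (hp ⟨_, hv⟩) ⟨v, rfl⟩ _).1
          ((p ⟨_, hv⟩).2.1 ⟨v, rfl⟩)
        rw [hk ⟨_, hv⟩ ⟨v, rfl⟩]
        exact h1
      · have h1 : ¬ G.Nontrivial A (G.cls A v) := fun h1 => hv (nontrivial_mono hA h1)
        exact ⟨fun h => absurd h h1, fun h => absurd h h1, fun h => absurd h h1,
          fun _ => dif_neg hv⟩
    have hkA : ∀ v w, (G.joined A).r v w → k v = k w := by
      intro v w hvw
      rw [← cls_eq_iff] at hvw
      by_cases hv : G.Nontrivial D.1.1 (G.cls D.1.1 v)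
      · have hw : G.cls D.1.1 w = G.cls D.1.1 v := (cls_mono hA hvw).symm
        rw [hk ⟨_, hv⟩ ⟨v, rfl⟩, hk ⟨_, hv⟩ ⟨w, hw⟩]
        exact congrArg (p ⟨_, hv⟩).1.2 ((component_cls_eq_iff hA (hp ⟨_, hv⟩) _ _).2 hvw)
      · rw [(G.cls_eq_of_not_nontrivial (fun h1 => hv (nontrivial_mono hA h1)) w).1 hvw.symm]
    let D' : G.Extraction := ⟨⟨A, Quotient.lift k hkA⟩, isExtraction_iff.2
      ⟨fun h => D.2.proper (Set.eq_univ_of_univ_subset (h ▸ hA)), hd⟩⟩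
    have hD : D'.Nested D := by
      refine ⟨hA, fun v hv => ?_⟩
      by_cases hn : G.Nontrivial D.1.1 (G.cls D.1.1 v)
      -- The family takes everything in this component; the clause on `res` in `FullExtraction` is
      -- there to give equal types in this case.
      · have h1 : (p ⟨_, hn⟩).1.1 = Set.univ := Set.eq_univ_of_forall fun x =>
          (hp _ x).2 (hv x.1 x.2.1 (x.2.2 false))
        exact (((p ⟨_, hn⟩).2.2 h1 _).symm.trans (hk ⟨_, hn⟩ ⟨v, rfl⟩).symm :)
      · have h1 : k v = G.kind v := dif_neg hn
        exact (D.2.kind_eq v hn).trans h1.symm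
    exact ⟨⟨D', hD⟩, funext fun c => FullExtraction.ext_kindAt
      (Set.ext fun x => (hp c x).symm) fun x => hk c x⟩

end Extraction

theorem component_isFeynman_of_isDivergentAt {G : FGraph T S} (hG : G.IsFeynman) {F : Set G.E}
    {κ : G.Comp F → Option T} (h : ∀ v, G.IsDivergentAt F (κ (G.cls F v)) v) (c : G.Comp F)
    (hc : G.Nontrivial F c) : (G.component F c (κ c)).IsFeynman where
  phi4 := fun v => by
    rw [component_valence]
    exact hG.phi4 v.1
  onePI := by
    induction c using Quotient.inductionOn
    exact (h _).onePI hc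
  res_iff := by
    induction c using Quotient.inductionOn
    exact (h _).kind_iff hc

theorem FullExtraction.isExtraction {G : FGraph T S} (D : G.FullExtraction)
    (hD : D.1.1 ≠ Set.univ) : G.IsExtraction D.1.1 D.1.2 :=
  isExtraction_iff.2 ⟨hD, D.2.1⟩

theorem Extraction.legs_component {G : FGraph T S} (D : G.Extraction) {c : G.Comp D.1.1}
    (hc : G.Nontrivial D.1.1 c) : (G.component D.1.1 c (D.1.2 c)).legs = 2 ∨
      (G.component D.1.1 c (D.1.2 c)).legs = 4 := D.2.legs c hc

theorem component_nontrivial_iff {G : FGraph T S} {F : Set G.E} {c : G.Comp F} {r : Option T}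
    {C : Set G.E} (hC : C ⊆ F) {A : Set (G.component F c r).E} (hA : ∀ e, e ∈ A ↔ e.1 ∈ C)
    (v : (G.component F c r).V) :
    (G.component F c r).Nontrivial A ((G.component F c r).cls A v) ↔
      G.Nontrivial C (G.cls C v.1) := by
  rw [nontrivial_iff _ _ _ none, nontrivial_iff _ _ _ none]
  exact (G.componentComponent hC hA v none).e.nonempty_congr

instance (G : FGraph T S) [Finite T] : Finite G.FullExtraction :=
  inferInstanceAs (Finite {D : (Σ F : Set G.E, (G.Comp F → Option T)) //
    (∀ v, G.IsDivergentAt D.1 (D.2 (G.cls D.1 v)) v) ∧ (D.1 = Set.univ → ∀ c, D.2 c = G.res)})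

noncomputable instance (G : FGraph T S) [Finite T] : Fintype G.FullExtraction := Fintype.ofFinite _

/-- The whole graph, as one of its subgraphs. -/
def FullExtraction.whole {G : FGraph T S} (hG : G.IsFeynman) (hl : G.legs = 2 ∨ G.legs = 4) :
    G.FullExtraction :=
  ⟨⟨Set.univ, fun _ => G.res⟩, fun v => by
    have f := (G.componentUniv hG.onePI.2.1.2 (G.cls Set.univ v)).symm
    have hl' := f.legs_eq
    refine ⟨fun _ => f.isOnePI hG.onePI, fun _ => hl' ▸ hl, fun _ => hl' ▸ hG.res_iff,
      fun h => absurd ?_ h⟩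
    obtain ⟨e⟩ := hG.onePI.1
    exact ⟨e, trivial, false, (G.cls_eq_iff _ _ _).2 (hG.onePI.2.1.2 _ _)⟩, fun _ _ => rfl⟩

/-- A proper extraction, regarded as one that may consist of the whole graph. -/
def Extraction.toFull {G : FGraph T S} (D : G.Extraction) : G.FullExtraction :=
  ⟨D.1, D.isDivergentAt, fun h => absurd h D.2.proper⟩

/-- `none` stands for the term `G ⊗ 1`. The whole graph allows a single choice of types, so it is
counted once. -/
theorem toFull_bijective {G : FGraph T S} (hG : G.IsFeynman) (hl : G.legs = 2 ∨ G.legs = 4) :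
    Function.Bijective fun o : Option G.Extraction =>
      o.elim (FullExtraction.whole hG hl) Extraction.toFull := by
  constructor
  · rintro (_ | D) (_ | D') h
    · rfl
    · exact absurd (congrArg (fun E => E.1.1) h).symm D'.2.proper
    · exact absurd (congrArg (fun E => E.1.1) h) D.2.proper
    · exact congrArg some (Subtype.ext (congrArg (fun E => E.1) h))
  · intro D
    by_cases hD : D.1.1 = Set.univ
    · exact ⟨none, FullExtraction.ext_kindAt hD.symm fun v => (D.2.2 hD _).symm⟩
    · exact ⟨some ⟨D.1, D.isExtraction hD⟩, rfl⟩

namespace Extraction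

variable {G : FGraph T S}

/-- The components of a nested extraction in a component of the larger extraction. -/
def restrictComp (D D' : G.Extraction) (h : D'.Nested D) (c : G.Comp D.1.1) :
    (G.component D.1.1 c (D.1.2 c)).Comp (D'.restrict D h c).1.1 → G.Comp D'.1.1 :=
  Quotient.lift (fun x => G.cls D'.1.1 x.1) fun x y hxy =>
    (component_cls_eq_iff h.1 (fun _ => Iff.rfl) x y).1 ((cls_eq_iff _ _ x y).2 hxy)

theorem restrictComp_nontrivial_iff (D D' : G.Extraction) (h : D'.Nested D) (c : G.Comp D.1.1)
    (d : (G.component D.1.1 c (D.1.2 c)).Comp (D'.restrict D h c).1.1) :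
    G.Nontrivial D'.1.1 (restrictComp D D' h c d) ↔
      (G.component D.1.1 c (D.1.2 c)).Nontrivial (D'.restrict D h c).1.1 d := by
  induction d using Quotient.inductionOn with
  | h x => exact (component_nontrivial_iff h.1 (fun _ => Iff.rfl) x).symm

theorem restrictComp_mono (D D' : G.Extraction) (h : D'.Nested D) {c c' : G.Comp D.1.1}
    {d : (G.component D.1.1 c (D.1.2 c)).Comp (D'.restrict D h c).1.1}
    {d' : (G.component D.1.1 c' (D.1.2 c')).Comp (D'.restrict D h c').1.1}
    (hd : restrictComp D D' h c d = restrictComp D D' h c' d') : c = c' := by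
  induction d using Quotient.inductionOn with
  | h x =>
  induction d' using Quotient.inductionOn with
  | h y => exact x.2.symm.trans ((cls_mono (v := x.1) (w := y.1) h.1 hd).trans y.2)

theorem restrictComp_injective (D D' : G.Extraction) (h : D'.Nested D) (c : G.Comp D.1.1) :
    Function.Injective (restrictComp D D' h c) := by
  intro d d' hd
  induction d using Quotient.inductionOn with
  | h x =>
  induction d' using Quotient.inductionOn with
  | h y => exact (component_cls_eq_iff h.1 (fun _ => Iff.rfl) x y).2 hd

/-- Every nontrivial component of `D'` lies in a unique component of `D`, which is then nontrivial
too. -/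
theorem restrictComp_bijective (D D' : G.Extraction) (h : D'.Nested D) :
    Function.Bijective fun p : (Σ c : {c : G.Comp D.1.1 // G.Nontrivial D.1.1 c},
      {d : (G.component D.1.1 c.1 (D.1.2 c.1)).Comp (D'.restrict D h c.1).1.1 //
        (G.component D.1.1 c.1 (D.1.2 c.1)).Nontrivial (D'.restrict D h c.1).1.1 d}) =>
      (⟨restrictComp D D' h p.1.1 p.2.1, (restrictComp_nontrivial_iff D D' h _ _).2 p.2.2⟩ :
        {d : G.Comp D'.1.1 // G.Nontrivial D'.1.1 d}) := by
  constructor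
  · rintro ⟨⟨c, hc⟩, ⟨d, hd⟩⟩ ⟨⟨c', hc'⟩, ⟨d', hd'⟩⟩ hp
    replace hp : restrictComp D D' h c d = restrictComp D D' h c' d' := congrArg Subtype.val hp
    obtain rfl := restrictComp_mono D D' h hp
    obtain rfl := restrictComp_injective D D' h c hp
    rfl
  · rintro ⟨d, hd⟩
    induction d using Quotient.inductionOn with
    | h v =>
      exact ⟨⟨⟨G.cls D.1.1 v, nontrivial_mono h.1 hd⟩, ⟨cls _ (D'.restrict D h _).1.1 ⟨v, rfl⟩,
        (component_nontrivial_iff h.1 (fun _ => Iff.rfl) _).2 hd⟩⟩, rfl⟩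

end Extraction

end FGraph

open FGraph

/-! ### Products over the components of nested extractions -/

section Algebra

variable (K : Type*) [Field K] {T S : Type}

theorem prod_finprod_eq_of_bijective {ι β M : Type*} [Fintype ι] {α : ι → Type*}
    [∀ i, Finite (α i)] [Finite β] [CommMonoid M] (f : ∀ i, α i → M) (g : β → M)
    (e : (Σ i, α i) → β) (he : Function.Bijective e) (h : ∀ i a, f i a = g (e ⟨i, a⟩)) :
    ∏ i, ∏ᶠ a, f i a = ∏ᶠ b, g b := by
  have := Fintype.ofFinite β
  have := fun i => Fintype.ofFinite (α i)
  simp_rw [finprod_eq_prod_of_fintype]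
  rw [← Fintype.prod_bijective e he (fun p => f p.1 p.2) g fun p => h p.1 p.2, Fintype.prod_sigma]

theorem liftHom_gen {B : Type*} [CommRing B] [Algebra K B] (φ : FeynmanClass T S → B)
    {G : FGraph T S} (hG : G.IsFeynman) :
    liftHom K φ (gen K G hG) = φ (Quotient.mk (feynmanSetoid T S) ⟨G, hG⟩) :=
  MvPolynomial.aeval_X φ _

theorem graphAlgebra_algHom_ext {B : Type*} [Semiring B] [Algebra K B]
    {f g : GraphAlgebra K T S →ₐ[K] B}
    (h : ∀ (G : FGraph T S) (hG : G.IsFeynman), f (gen K G hG) = g (gen K G hG)) : f = g :=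
  MvPolynomial.algHom_ext (R := K) fun x => by
    obtain ⟨⟨G, hG⟩, rfl⟩ := Quotient.exists_rep x
    exact h G hG

theorem comulHom_gen [Finite T] {G : FGraph T S} (hG : G.IsFeynman) :
    comulHom K T S (gen K G hG) = comulGraph K hG :=
  liftHom_gen K _ hG

theorem counitHom_gen {G : FGraph T S} (hG : G.IsFeynman) :
    counitHom K T S (gen K G hG) = 0 :=
  liftHom_gen K _ hG

/-- The disjoint union of the components of the extracted subgraph. -/
noncomputable def fullExtracted {G : FGraph T S} (hG : G.IsFeynman) (D : G.FullExtraction) :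
    GraphAlgebra K T S :=
  ∏ᶠ c : {c : G.Comp D.1.1 // G.Nontrivial D.1.1 c},
    gen K (G.component D.1.1 c.1 (D.1.2 c.1))
      (component_isFeynman_of_isDivergentAt hG D.2.1 c.1 c.2)

open Classical in
/-- The graph in which the extracted subgraph is shrunk; nothing remains of the whole graph. -/
noncomputable def fullCograph {G : FGraph T S} (hG : G.IsFeynman) (D : G.FullExtraction) :
    GraphAlgebra K T S :=
  if h : D.1.1 = Set.univ then 1
  else gen K (G.contract D.1.1 D.1.2) (contract_isFeynman hG (D.isExtraction h))

theorem fullExtracted_whole {G : FGraph T S} (hG : G.IsFeynman) (hl : G.legs = 2 ∨ G.legs = 4) :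
    fullExtracted K hG (FullExtraction.whole hG hl) = gen K G hG := by
  obtain ⟨e⟩ := hG.onePI.1
  have hc : ∀ c, c = G.cls Set.univ (G.ends e false) := by
    intro c
    induction c using Quotient.inductionOn
    exact (G.cls_eq_iff _ _ _).2 (hG.onePI.2.1.2 _ _)
  refine (finprod_eq_single _ ⟨G.cls Set.univ (G.ends e false), e, trivial, false, rfl⟩
    fun c h => absurd (Subtype.ext (hc c.1)) h).trans ?_
  exact gen_congr K _ _ (G.componentUniv hG.onePI.2.1.2 _)

/-- With two or four legs the whole graph is itself divergent and accounts for `G ⊗ 1`. Written as a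
single sum, the coproducts of several components can be multiplied out. -/
theorem comulGraph_eq_sum_fullExtraction [Finite T] {G : FGraph T S} (hG : G.IsFeynman)
    (hl : G.legs = 2 ∨ G.legs = 4) : comulGraph K hG =
      ∑ D : G.FullExtraction, fullExtracted K hG D ⊗ₜ[K] fullCograph K hG D := by
  rw [← (toFull_bijective hG hl).sum_comp, Fintype.sum_option]
  refine congrArg₂ (· + ·) ?_ (Finset.sum_congr rfl fun D _ => ?_)
  · change _ = fullExtracted K hG (FullExtraction.whole hG hl) ⊗ₜ[K]
      fullCograph K hG (FullExtraction.whole hG hl)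
    rw [fullExtracted_whole, fullCograph, dif_pos (by rfl)]
  · change _ = fullExtracted K hG D.toFull ⊗ₜ[K] fullCograph K hG D.toFull
    rw [fullCograph, dif_neg (show ¬ D.toFull.1.1 = Set.univ from D.2.proper)]
    rfl

theorem prod_fullExtracted_restrict {G : FGraph T S} (hG : G.IsFeynman) (D D' : G.Extraction)
    (h : D'.Nested D) [Fintype {c : G.Comp D.1.1 // G.Nontrivial D.1.1 c}] :
    ∏ c : {c : G.Comp D.1.1 // G.Nontrivial D.1.1 c},
      fullExtracted K (component_isFeynman hG D.2 c.1 c.2) (D'.restrict D h c.1) =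
    extracted K hG D' := by
  refine prod_finprod_eq_of_bijective _ _ _ (Extraction.restrictComp_bijective D D' h) ?_
  rintro ⟨c, hc⟩ ⟨d, hd⟩
  induction d using Quotient.inductionOn with
  | h x => exact gen_congr K _ _ (G.componentComponent h.1 (fun _ => Iff.rfl) x (D'.kindAt x.1))

/-- Components of `D` contained in `D'` contribute the factor `1` on the left and are absent on the
right; the remaining factors agree by `componentContract`. -/
theorem prod_fullCograph_restrict {G : FGraph T S} (hG : G.IsFeynman) (D D' : G.Extraction)
    (h : D'.Nested D) [Fintype {c : G.Comp D.1.1 // G.Nontrivial D.1.1 c}] :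
    ∏ c : {c : G.Comp D.1.1 // G.Nontrivial D.1.1 c},
      fullCograph K (component_isFeynman hG D.2 c.1 c.2) (D'.restrict D h c.1) =
    extracted K (contract_isFeynman hG D'.2) (D'.quot D h) := by
  have := Fintype.ofFinite {c : (G.contract D'.1.1 D'.1.2).Comp (D'.quot D h).1.1 //
    (G.contract D'.1.1 D'.1.2).Nontrivial (D'.quot D h).1.1 c}
  unfold extracted
  rw [finprod_eq_prod_of_fintype]
  symm
  have hn : ∀ c, (G.contract D'.1.1 D'.1.2).Nontrivial (D'.quot D h).1.1 (D'.quotComp D h c) ↔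
      ∃ e ∈ D.1.1, G.cls D.1.1 (G.ends e false) = c ∧ e ∉ D'.1.1 := by
    intro c
    induction c using Quotient.inductionOn with
    | h v => exact contract_nontrivial_iff h.1 (fun _ => Iff.rfl) v
  let φ : {c : (G.contract D'.1.1 D'.1.2).Comp (D'.quot D h).1.1 //
    (G.contract D'.1.1 D'.1.2).Nontrivial (D'.quot D h).1.1 c} →
      {c : G.Comp D.1.1 // G.Nontrivial D.1.1 c} := fun c => ⟨(D'.quotComp D h).symm c.1, by
        obtain ⟨e, he, h1, -⟩ := (hn ((D'.quotComp D h).symm c.1)).1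
          (((D'.quotComp D h).apply_symm_apply c.1).symm ▸ c.2)
        exact ⟨e, he, false, h1⟩⟩
  refine Fintype.prod_of_injective φ (fun c d hcd => Subtype.ext
    ((D'.quotComp D h).symm.injective (congrArg Subtype.val hcd))) _ _ (fun c hc => ?_) fun c => ?_
  -- A component outside the image of `φ` has no edge left after shrinking `D'`, so its factor is
  -- `1`.
  · refine dif_pos (Set.eq_univ_of_forall fun x => ?_)
    by_contra hx
    refine hc ⟨⟨D'.quotComp D h c.1, (hn c.1).2 ⟨x.1, x.2.1, x.2.2 false, hx⟩⟩, Subtype.ext ?_⟩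
    exact (D'.quotComp D h).symm_apply_apply c.1
  · obtain ⟨c, hc⟩ := c
    obtain ⟨c, rfl⟩ := (D'.quotComp D h).surjective c
    have hc' := (hn c).1 hc
    have hφ : φ ⟨_, hc⟩ = ⟨c, by obtain ⟨e, he, h1, -⟩ := hc'; exact ⟨e, he, false, h1⟩⟩ :=
      Subtype.ext ((D'.quotComp D h).symm_apply_apply c)
    rw [hφ]
    induction c using Quotient.inductionOn with
    | h v =>
    have hu : ¬ (D'.restrict D h (G.cls D.1.1 v)).1.1 = Set.univ := by
      obtain ⟨e, he, h1, h2⟩ := hc'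
      exact fun hu => h2 (mem_of_eq_univ hu ⟨e, he, fun b => (G.cls_ends he b false).trans h1⟩ :)
    refine Eq.trans ?_ (dif_neg hu).symm
    let f := G.componentContract h.1 D'.1.2 (B := D'.quotEdges D) (fun _ => Iff.rfl) v (D.kindAt v)
      (fun _ => Iff.rfl) (D'.restrict D h (G.cls D.1.1 v)).1.2 fun _ => rfl
    have h1 := component_isFeynman (contract_isFeynman hG D'.2) (D'.quot D h).2 _ hc
    have hk : (D'.quot D h).1.2 (D'.quotComp D h (G.cls D.1.1 v)) = D.kindAt v :=
      D'.quot_kindAt D h v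
    have h2 : ((G.contract D'.1.1 D'.1.2).component (D'.quotEdges D)
      (D'.quotComp D h (G.cls D.1.1 v)) (D.kindAt v)).IsFeynman := hk ▸ h1
    exact (gen_component_congr K hk h1 h2).trans (gen_congr K _ _ f).symm

end Algebra

/-! ### Coassociativity -/

section Algebra

variable (K : Type*) [Field K] {T S : Type}

noncomputable instance [Finite T] {G : FGraph T S} (p : G.Extraction → Prop) :
    Fintype {D : G.Extraction // p D} := Fintype.ofFinite _

theorem prod_tmul_prod {ι A B : Type*} [Fintype ι] [CommRing A] [Algebra K A] [CommRing B]
    [Algebra K B] (f : ι → A) (g : ι → B) :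
    ∏ i, f i ⊗ₜ[K] g i = (∏ i, f i) ⊗ₜ[K] (∏ i, g i) := by
  classical
  have : ∀ s : Finset ι, ∏ i ∈ s, f i ⊗ₜ[K] g i = (∏ i ∈ s, f i) ⊗ₜ[K] (∏ i ∈ s, g i) := by
    intro s
    induction s using Finset.induction_on with
    | empty => simp [Algebra.TensorProduct.one_def]
    | insert a s ha ih => simp [Finset.prod_insert ha, ih]
  exact this _

/-- Multiplying out the coproducts of the components gives a sum over families of full extractions,
which `restrict_bijective` turns into a sum over nested `D'`. -/
theorem comulHom_extracted [Finite T] {G : FGraph T S} (hG : G.IsFeynman) (D : G.Extraction) :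
    comulHom K T S (extracted K hG D) = ∑ D' : {D' : G.Extraction // D'.Nested D},
      extracted K hG D'.1 ⊗ₜ[K] extracted K (contract_isFeynman hG D'.1.2) (D'.1.quot D D'.2) := by
  classical
  have := Fintype.ofFinite {c : G.Comp D.1.1 // G.Nontrivial D.1.1 c}
  unfold extracted
  rw [finprod_eq_prod_of_fintype, map_prod]
  simp_rw [comulHom_gen]
  rw [Finset.prod_congr rfl fun c _ => comulGraph_eq_sum_fullExtraction K
    (component_isFeynman hG D.2 c.1 c.2) (D.legs_component c.2), Fintype.prod_sum,
    ← D.restrict_bijective.sum_comp]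
  refine Finset.sum_congr rfl fun D' _ => ?_
  refine (prod_tmul_prod K _ _).trans ?_
  exact congrArg₂ (· ⊗ₜ[K] ·) (prod_fullExtracted_restrict K hG D D'.1 D'.2)
    (prod_fullCograph_restrict K hG D D'.1 D'.2)

/-- Extractions of the cograph come from larger extractions by `quot_bijective`, and shrinking in
two steps is shrinking at once (`contractContract`). -/
theorem comulHom_cograph [Finite T] {G : FGraph T S} (hG : G.IsFeynman) (D' : G.Extraction) :
    comulHom K T S (cograph K hG D') = cograph K hG D' ⊗ₜ[K] 1 +
      ∑ D : {D : G.Extraction // D'.Nested D},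
        extracted K (contract_isFeynman hG D'.2) (D'.quot D.1 D.2) ⊗ₜ[K] cograph K hG D.1 := by
  refine (comulHom_gen K _).trans (congrArg₂ (· + ·) rfl ?_)
  rw [← D'.quot_bijective.sum_comp]
  refine Finset.sum_congr rfl fun D _ => congrArg _ ?_
  exact gen_congr K _ _ (G.contractContract D.2.1 D'.1.2 (B := D'.quotEdges D.1) (fun _ => Iff.rfl)
    (D'.quot D.1 D.2).1.2 D.1.1.2 (D'.quot_kindAt D.1 D.2)).symm

variable (T S)

/-- The associator matters only through its values on pure tensors, hence the general `α`. -/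
theorem comulHom_coassoc [Finite T]
    (α : (GraphAlgebra K T S ⊗[K] GraphAlgebra K T S) ⊗[K] GraphAlgebra K T S →ₐ[K]
      GraphAlgebra K T S ⊗[K] (GraphAlgebra K T S ⊗[K] GraphAlgebra K T S))
    (hα : ∀ x y z, α ((x ⊗ₜ[K] y) ⊗ₜ[K] z) = x ⊗ₜ[K] (y ⊗ₜ[K] z)) :
    (α.comp (Algebra.TensorProduct.map (comulHom K T S) (AlgHom.id K _))).comp (comulHom K T S) =
    (Algebra.TensorProduct.map (AlgHom.id K _) (comulHom K T S)).comp (comulHom K T S) := by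
  refine graphAlgebra_algHom_ext K fun G hG => ?_
  simp only [AlgHom.comp_apply, comulHom_gen]
  unfold comulGraph
  simp only [map_add, map_sum, Algebra.TensorProduct.map_tmul, AlgHom.id_apply, map_one,
    comulHom_gen, comulHom_extracted, comulHom_cograph]
  unfold comulGraph
  simp only [TensorProduct.add_tmul, TensorProduct.sum_tmul, TensorProduct.tmul_add,
    TensorProduct.tmul_sum, map_add, map_sum, hα, Algebra.TensorProduct.one_def,
    Finset.sum_add_distrib]
  rw [add_assoc]
  -- The terms `G ⊗ 1 ⊗ 1` and `g ⊗ G/g ⊗ 1` match literally; what remains is the double sum over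
  -- nested pairs, taken in the two orders.
  refine congrArg₂ (· + ·) rfl (congrArg₂ (· + ·) rfl ?_)
  let e : (Σ D : G.Extraction, {D' : G.Extraction // D'.Nested D}) ≃
      (Σ D' : G.Extraction, {D : G.Extraction // D'.Nested D}) :=
    { toFun := fun p => ⟨p.2.1, p.1, p.2.2⟩
      invFun := fun p => ⟨p.2.1, p.1, p.2.2⟩
      left_inv := fun _ => rfl
      right_inv := fun _ => rfl }
  rw [← Fintype.sum_sigma', ← Fintype.sum_sigma']
  exact Fintype.sum_equiv e _ _ fun _ => rfl

end Algebra

/-! ### The empty extraction, the counit axioms and the bialgebra structure -/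

namespace FGraph

variable {T S : Type}

/-- The extraction of the empty subgraph. -/
def emptyExtraction {G : FGraph T S} (hG : G.IsFeynman) : G.Extraction :=
  ⟨⟨∅, Quotient.lift G.kind fun _ _ h => congrArg G.kind
    ((G.cls_eq_of_not_nontrivial (fun ⟨_, he, _⟩ => he) _).1 (Quotient.sound h))⟩, by
    refine isExtraction_iff.2 ⟨fun h => ?_, fun v => ⟨fun ⟨_, he, _⟩ => absurd he id,
      fun ⟨_, he, _⟩ => absurd he id, fun ⟨_, he, _⟩ => absurd he id, fun _ => rfl⟩⟩
    obtain ⟨e⟩ := hG.onePI.1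
    exact mem_of_eq_univ h e⟩

/-- Shrinking the empty subgraph does not change the graph. -/
noncomputable def contractEmpty {G : FGraph T S} (hG : G.IsFeynman) :
    G.Iso (G.contract (emptyExtraction hG).1.1 (emptyExtraction hG).1.2) where
  v := Equiv.ofBijective (G.cls ∅) ⟨fun _ _ h =>
    (G.cls_eq_of_not_nontrivial (fun ⟨_, he, _⟩ => he) _).1 h, Quotient.exists_rep⟩
  e := (Equiv.subtypeUnivEquiv fun _ h => h).symm
  l := Equiv.refl _
  ends := fun _ => Or.inl fun _ => rfl
  att := fun _ => rfl
  kind := fun _ => rfl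
  res := rfl
  lab := fun _ => rfl

theorem eq_emptyExtraction {G : FGraph T S} (hG : G.IsFeynman) (D : G.Extraction)
    (h : ∀ c, ¬ G.Nontrivial D.1.1 c) : D = emptyExtraction hG :=
  Extraction.ext_kindAt (Set.eq_empty_of_forall_notMem fun e he => h _ ⟨e, he, false, rfl⟩)
    fun v => D.2.kind_eq v (h _)

/-- A proper subgraph misses an edge, and so does each of its components. This makes the recursion
for the antipode terminate. -/
theorem card_component_lt {G : FGraph T S} (D : G.Extraction) (c : G.Comp D.1.1) :
    Nat.card (G.component D.1.1 c (D.1.2 c)).E < Nat.card G.E := by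
  obtain ⟨e, he⟩ := (Set.ne_univ_iff_exists_notMem _).1 D.2.proper
  refine Finite.card_subtype_lt (x := e) fun h => he h.1

end FGraph

section Algebra

variable (K : Type*) [Field K] {T S : Type}

theorem extracted_emptyExtraction {G : FGraph T S} (hG : G.IsFeynman) :
    extracted K hG (emptyExtraction hG) = 1 :=
  finprod_eq_one_of_forall_eq_one fun c => absurd c.2 fun ⟨_, he, _⟩ => he

theorem cograph_emptyExtraction {G : FGraph T S} (hG : G.IsFeynman) :
    cograph K hG (emptyExtraction hG) = gen K G hG :=
  (gen_congr K _ _ (contractEmpty hG)).symm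

theorem map_extracted {B : Type*} [CommRing B] [Algebra K B] (f : GraphAlgebra K T S →ₐ[K] B)
    {G : FGraph T S} (hG : G.IsFeynman) (D : G.Extraction) :
    f (extracted K hG D) = ∏ᶠ c : {c : G.Comp D.1.1 // G.Nontrivial D.1.1 c},
      f (gen K (G.component D.1.1 c.1 (D.1.2 c.1)) (component_isFeynman hG D.2 c.1 c.2)) :=
  (f : GraphAlgebra K T S →* B).map_finprod (Set.toFinite _)

/-- A nonempty extraction has a component, hence a generator among its factors. -/
theorem counitHom_extracted {G : FGraph T S} (hG : G.IsFeynman) (D : G.Extraction)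
    (hD : D ≠ emptyExtraction hG) : counitHom K T S (extracted K hG D) = 0 := by
  obtain ⟨c, hc⟩ : ∃ c, G.Nontrivial D.1.1 c := by
    by_contra! h
    exact hD (eq_emptyExtraction hG D h)
  have := Fintype.ofFinite {c : G.Comp D.1.1 // G.Nontrivial D.1.1 c}
  rw [map_extracted, finprod_eq_prod_of_fintype]
  exact Finset.prod_eq_zero (Finset.mem_univ ⟨c, hc⟩) (counitHom_gen K _)

/-- This is the convolution product of `f` and `g` evaluated on a generator. -/
theorem lift_comulHom_gen [Finite T] {B : Type*} [CommRing B] [Algebra K B]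
    (f g : GraphAlgebra K T S →ₐ[K] B) {G : FGraph T S} (hG : G.IsFeynman) :
    Algebra.TensorProduct.lift f g (fun _ _ => .all ..) (comulHom K T S (gen K G hG)) =
      f (gen K G hG) + ∑ D : G.Extraction, f (extracted K hG D) * g (cograph K hG D) := by
  rw [comulHom_gen]
  simp [comulGraph]

variable (T S)

theorem counitHom_rTensor [Finite T] :
    (Algebra.TensorProduct.map (counitHom K T S) (AlgHom.id K _)).comp (comulHom K T S) =
      Algebra.TensorProduct.includeRight := by
  refine graphAlgebra_algHom_ext K fun G hG => ?_
  rw [AlgHom.comp_apply, comulHom_gen, comulGraph, map_add, map_sum,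
    Finset.sum_eq_single (emptyExtraction hG)]
  · simp [counitHom_gen, extracted_emptyExtraction, cograph_emptyExtraction]
  · intro D _ hD
    simp [counitHom_extracted K hG D hD]
  · simp

/-- Extractions are proper, so every cograph is a generator and only `G ⊗ 1` survives. -/
theorem counitHom_lTensor [Finite T] :
    (Algebra.TensorProduct.map (AlgHom.id K _) (counitHom K T S)).comp (comulHom K T S) =
      Algebra.TensorProduct.includeLeft := by
  refine graphAlgebra_algHom_ext K fun G hG => ?_
  rw [AlgHom.comp_apply, comulHom_gen, comulGraph, map_add, map_sum,
    Finset.sum_eq_zero fun D _ => by simp [cograph, counitHom_gen]]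
  simp

noncomputable instance [Finite T] : Coalgebra K (GraphAlgebra K T S) where
  coassoc := by
    have h := congrArg AlgHom.toLinearMap (comulHom_coassoc K T S
      (Algebra.TensorProduct.assoc K K K _ _ _).toAlgHom fun _ _ _ => rfl)
    exact h
  rTensor_counit_comp_comul := congrArg AlgHom.toLinearMap (counitHom_rTensor K T S)
  lTensor_counit_comp_comul := congrArg AlgHom.toLinearMap (counitHom_lTensor K T S)

noncomputable instance [Finite T] : Bialgebra K (GraphAlgebra K T S) :=
  Bialgebra.mk' K (GraphAlgebra K T S) (map_one (counitHom K T S))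
    (fun {a b} => map_mul (counitHom K T S) a b) (map_one (comulHom K T S))
    (fun {a b} => map_mul (comulHom K T S) a b)

end Algebra

/-! ### Convolution inverses and the antipode -/

section Algebra

variable (K : Type*) [Field K] {T S : Type}

/-- The number of internal edges of a class of graphs. -/
noncomputable def FeynmanClass.size : FeynmanClass T S → ℕ :=
  Quotient.lift (fun G => Nat.card G.1.E) fun _ _ ⟨f⟩ => Nat.card_congr f.e

/-- Approximations of the convolution inverse of `f`, which are exact on the graphs with less than
`n` internal edges. -/
noncomputable def approxInv [Finite T] {B : Type*} [CommRing B] [Algebra K B]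
    (f : GraphAlgebra K T S →ₐ[K] B) : ℕ → (GraphAlgebra K T S →ₐ[K] B)
  | 0 => liftHom K fun _ => 0
  -- This is the iteration `g ↦ g - g * f` on generators, with the convolution product; at a fixed
  -- point `g * f` vanishes there, like the convolution unit. The value of `g` at `x` itself
  -- cancels, which leaves only graphs with fewer edges.
  | n + 1 => liftHom K fun x => approxInv f n (MvPolynomial.X x : MvPolynomial _ K) -
      Algebra.TensorProduct.lift (approxInv f n) f (fun _ _ => .all ..)
        (comulHom K T S (MvPolynomial.X x : MvPolynomial _ K))

theorem approxInv_succ [Finite T] {B : Type*} [CommRing B] [Algebra K B]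
    (f : GraphAlgebra K T S →ₐ[K] B) (n : ℕ) {G : FGraph T S} (hG : G.IsFeynman) :
    approxInv K f (n + 1) (gen K G hG) =
      -∑ D : G.Extraction, approxInv K f n (extracted K hG D) * f (cograph K hG D) := by
  rw [approxInv, liftHom_gen]
  change approxInv K f n (gen K G hG) - Algebra.TensorProduct.lift (approxInv K f n) f
    (fun _ _ => .all ..) (comulHom K T S (gen K G hG)) = _
  rw [lift_comulHom_gen]
  ring

theorem map_extracted_congr {B : Type*} [CommRing B] [Algebra K B]
    (f g : GraphAlgebra K T S →ₐ[K] B) {G : FGraph T S} (hG : G.IsFeynman) (D : G.Extraction)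
    (h : ∀ (H : FGraph T S) (hH : H.IsFeynman), Nat.card H.E < Nat.card G.E →
      f (gen K H hH) = g (gen K H hH)) : f (extracted K hG D) = g (extracted K hG D) := by
  rw [map_extracted, map_extracted]
  exact finprod_congr fun c => h _ _ (card_component_lt D c.1)

/-- Each unfolding lowers both the level and the number of edges, so a level above the number of
edges never reaches the arbitrary starting value. -/
theorem approxInv_stable [Finite T] {B : Type*} [CommRing B] [Algebra K B]
    (f : GraphAlgebra K T S →ₐ[K] B) (n m : ℕ) {G : FGraph T S} (hG : G.IsFeynman)
    (hn : Nat.card G.E < n) (hm : Nat.card G.E < m) :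
    approxInv K f n (gen K G hG) = approxInv K f m (gen K G hG) := by
  induction n generalizing m G with
  | zero => omega
  | succ n ih =>
    obtain _ | m := m
    · omega
    rw [approxInv_succ, approxInv_succ]
    congr 1
    refine Finset.sum_congr rfl fun D _ => congrArg (· * _) ?_
    exact map_extracted_congr K _ _ hG D fun H hH hlt => ih m hH (by omega) (by omega)

open WithConv in
theorem exists_left_convInv [Finite T] {B : Type*} [CommRing B] [Algebra K B]
    (f : WithConv (GraphAlgebra K T S →ₐ[K] B)) :
    ∃ g : WithConv (GraphAlgebra K T S →ₐ[K] B), g * f = 1 := by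
  -- `x.size + 1` is the least level to which `approxInv_stable` applies for `x`.
  let g : GraphAlgebra K T S →ₐ[K] B := liftHom K fun x =>
    approxInv K f.ofConv (x.size + 1) (MvPolynomial.X x : MvPolynomial _ K)
  have hg : ∀ (H : FGraph T S) (hH : H.IsFeynman),
      g (gen K H hH) = approxInv K f.ofConv (Nat.card H.E + 1) (gen K H hH) :=
    fun H hH => liftHom_gen K _ hH
  refine ⟨toConv g, ofConv_injective (graphAlgebra_algHom_ext K fun G hG => ?_)⟩
  have h1 : (toConv g * f).ofConv (gen K G hG) = Algebra.TensorProduct.lift g f.ofConv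
      (fun _ _ => .all ..) (comulHom K T S (gen K G hG)) := AlgHom.convMul_apply _ _ _
  have h2 : (1 : WithConv (GraphAlgebra K T S →ₐ[K] B)).ofConv (gen K G hG) =
      algebraMap K B (counitHom K T S (gen K G hG)) := rfl
  rw [h1, h2, lift_comulHom_gen, counitHom_gen, hg, approxInv_succ, map_zero, neg_add_eq_zero]
  refine Finset.sum_congr rfl fun D _ => congrArg (· * _) ?_
  refine map_extracted_congr K _ _ hG D fun H hH hlt => ?_
  rw [hg]
  exact approxInv_stable K _ _ _ hH hlt (Nat.lt_succ_self _)

/-- The left inverse `g` has a left inverse as well, which must be `f` by associativity of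
convolution. -/
theorem exists_convInv [Finite T] {B : Type*} [CommRing B] [Algebra K B]
    (f : WithConv (GraphAlgebra K T S →ₐ[K] B)) :
    ∃ g : WithConv (GraphAlgebra K T S →ₐ[K] B), g * f = 1 ∧ f * g = 1 := by
  obtain ⟨g, hg⟩ := exists_left_convInv K f
  obtain ⟨g', hg'⟩ := exists_left_convInv K g
  refine ⟨g, hg, ?_⟩
  rwa [← left_inv_eq_right_inv hg' hg]

open WithConv in
-- The antipode axioms are the two convolution identities, read as equalities of linear maps.
theorem isHopfAlgebra_of_convInv [Finite T] (s : GraphAlgebra K T S →ₐ[K] GraphAlgebra K T S)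
    (h1 : toConv s * toConv (AlgHom.id K _) = 1) (h2 : toConv (AlgHom.id K _) * toConv s = 1) :
    IsHopfAlgebra K (GraphAlgebra K T S) s.toLinearMap where
  coassoc := Coalgebra.coassoc
  counit_left := Coalgebra.rTensor_counit_comp_comul
  counit_right := Coalgebra.lTensor_counit_comp_comul
  counit_one := Bialgebra.counit_one
  counit_mul := Bialgebra.counit_mul
  comul_one := Bialgebra.comul_one
  comul_mul := Bialgebra.comul_mul
  antipode_left := congrArg (fun f => f.ofConv.toLinearMap) h1
  antipode_right := congrArg (fun f => f.ofConv.toLinearMap) h2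

end Algebra

/-! ### Scale assignments and compatibility with coproduct and counit -/

namespace FGraph

variable {T S S' : Type}

theorem relabel_isExtraction_iff (G : FGraph T S) (μ : G.E → S') {F : Set G.E}
    {κ : G.Comp F → Option T} : (G.relabel μ).IsExtraction F κ ↔ G.IsExtraction F κ :=
  ⟨fun h => ⟨h.proper, h.onePI, h.legs, h.kind_iff, h.kind_eq⟩,
    fun h => ⟨h.proper, h.onePI, h.legs, h.kind_iff, h.kind_eq⟩⟩

/-- The extractions do not depend on the labels of the edges. -/
def relabelExtraction (G : FGraph T S) (μ : G.E → S') : G.Extraction ≃ (G.relabel μ).Extraction :=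
  Equiv.subtypeEquivRight fun _ => (G.relabel_isExtraction_iff μ).symm

/-- The edges of a graph are those of the components of a subgraph and those outside of it. -/
noncomputable def edgesEquiv {G : FGraph T S} (D : G.Extraction) :
    ((Σ c : {c : G.Comp D.1.1 // G.Nontrivial D.1.1 c}, (G.component D.1.1 c.1 (D.1.2 c.1)).E) ⊕
      (G.contract D.1.1 D.1.2).E) ≃ G.E :=
  Equiv.ofBijective (Sum.elim (fun p => p.2.1) Subtype.val) ⟨by
    rintro (⟨⟨c, hc⟩, x⟩ | x) (⟨⟨c', hc'⟩, y⟩ | y) h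
    · replace h : x.1 = y.1 := h
      obtain rfl : c = c' := (x.2.2 false).symm.trans (h ▸ y.2.2 false)
      obtain rfl : x = y := Subtype.ext h
      rfl
    · exact absurd ((show x.1 = y.1 from h) ▸ x.2.1) y.2
    · exact absurd ((show x.1 = y.1 from h).symm ▸ y.2.1) x.2
    · exact congrArg Sum.inr (Subtype.ext h), fun e => by
    by_cases he : e ∈ D.1.1
    · exact ⟨Sum.inl ⟨⟨G.cls _ (G.ends e false), e, he, false, rfl⟩,
        ⟨e, he, fun b => G.cls_ends he b false⟩⟩, rfl⟩
    · exact ⟨Sum.inr ⟨e, he⟩, rfl⟩⟩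

/-- A labelling of the edges is given by labellings of the extracted components and of the
cograph. -/
noncomputable def labellingEquiv {G : FGraph T S} (D : G.Extraction) (R : Type) :
    (G.E → R) ≃ (∀ c : {c : G.Comp D.1.1 // G.Nontrivial D.1.1 c},
      (G.component D.1.1 c.1 (D.1.2 c.1)).E → R) × ((G.contract D.1.1 D.1.2).E → R) :=
  ((edgesEquiv D).arrowCongr (Equiv.refl R)).symm.trans ((Equiv.sumArrowEquivProdArrow _ _ _).trans
    ((Equiv.piCurry fun _ _ => R).prodCongr (Equiv.refl _)))

end FGraph

section Algebra

variable (K : Type*) [Field K] (T : Type) (ρ : ℕ)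

theorem piCK_gen {G : FGraph T Unit} (hG : G.IsFeynman) :
    piCK K T ρ (gen K G hG) = assignedSum K ρ hG :=
  liftHom_gen K _ hG

variable {T}

open Classical in
-- With the bound moved into the label type, the sum runs over a full function type and can be split
-- along `labellingEquiv`.
theorem assignedSum_eq {G : FGraph T Unit} (hG : G.IsFeynman) :
    assignedSum K ρ hG = ∑ μ : G.E → Finset.Iic ρ,
      gen K (G.relabel fun e => (μ e : ℕ)) (relabel_isFeynman hG _) := by
  symm
  refine Finset.sum_bij (fun μ _ e => (μ e : ℕ)) (fun μ _ => ?_) (fun μ _ ν _ h => ?_)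
    (fun μ hμ => ?_) fun _ _ => rfl
  · exact Fintype.mem_piFinset.2 fun e => (μ e).2
  · exact funext fun e => Subtype.ext (congrFun h e)
  · exact ⟨fun e => ⟨μ e, Fintype.mem_piFinset.1 hμ e⟩, Finset.mem_univ _, rfl⟩

open Classical in
-- Multiplying out gives one labelling per component and one of the cograph; as these partition the
-- edges, together they are one labelling of `G`.
theorem piCK_extracted_tmul_cograph {G : FGraph T Unit} (hG : G.IsFeynman) (D : G.Extraction) :
    piCK K T ρ (extracted K hG D) ⊗ₜ[K] piCK K T ρ (cograph K hG D) =
      ∑ μ : G.E → Finset.Iic ρ,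
        extracted K (relabel_isFeynman hG fun e => (μ e : ℕ)) (G.relabelExtraction _ D) ⊗ₜ[K]
          cograph K (relabel_isFeynman hG fun e => (μ e : ℕ)) (G.relabelExtraction _ D) := by
  have := Fintype.ofFinite {c : G.Comp D.1.1 // G.Nontrivial D.1.1 c}
  rw [map_extracted, finprod_eq_prod_of_fintype, cograph, piCK_gen, assignedSum_eq]
  simp_rw [piCK_gen, assignedSum_eq]
  rw [Fintype.prod_sum, TensorProduct.sum_tmul]
  simp_rw [TensorProduct.tmul_sum]
  rw [← Fintype.sum_prod_type', ← (labellingEquiv D _).sum_comp]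
  refine Finset.sum_congr rfl fun μ _ => congrArg₂ (· ⊗ₜ[K] ·) ?_ rfl
  exact (finprod_eq_prod_of_fintype _).symm

/-- The sums over labellings and over extractions can be exchanged because the set of extractions
does not depend on the labelling. -/
theorem piCK_comul [Finite T] :
    (Algebra.TensorProduct.map (piCK K T ρ) (piCK K T ρ)).comp (comulHom K T Unit) =
      (comulHom K T ℕ).comp (piCK K T ρ) := by
  classical
  refine graphAlgebra_algHom_ext K fun G hG => ?_
  rw [AlgHom.comp_apply, AlgHom.comp_apply, comulHom_gen, piCK_gen, comulGraph, map_add, map_sum,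
    assignedSum_eq, map_sum]
  simp_rw [Algebra.TensorProduct.map_tmul, comulHom_gen, piCK_extracted_tmul_cograph]
  unfold comulGraph
  rw [Finset.sum_add_distrib, Finset.sum_comm, map_one, piCK_gen, assignedSum_eq,
    TensorProduct.sum_tmul]
  refine congrArg _ (Finset.sum_congr rfl fun μ _ => ?_)
  exact Fintype.sum_equiv (G.relabelExtraction _) _ _ fun _ => rfl

theorem piCK_counit : (counitHom K T ℕ).comp (piCK K T ρ) = counitHom K T Unit := by
  classical
  refine graphAlgebra_algHom_ext K fun G hG => ?_
  rw [AlgHom.comp_apply, piCK_gen, counitHom_gen, assignedSum, map_sum]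
  exact Finset.sum_eq_zero fun μ _ => counitHom_gen K _

end Algebra

/-! ### Compatibility with the antipodes -/

open WithConv in
theorem mainTheorem5 (K : Type*) [Field K] (T : Type) [Finite T] [Nonempty T] (ρ : ℕ) :
    ∃ (S : CKAlgebra K T →ₗ[K] CKAlgebra K T)
      (S' : AssignedAlgebra K T →ₗ[K] AssignedAlgebra K T),
      IsHopfAlgebra K (CKAlgebra K T) S ∧ IsHopfAlgebra K (AssignedAlgebra K T) S' ∧
      ∃ π : CKAlgebra K T →ₐc[K] AssignedAlgebra K T,
        (π : CKAlgebra K T →ₐ[K] AssignedAlgebra K T) = piCK K T ρ ∧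
        ∀ x, π (S x) = S' (π x) := by
  obtain ⟨s, hs, hs'⟩ := exists_convInv K (toConv (AlgHom.id K (CKAlgebra K T)))
  obtain ⟨s', ht, ht'⟩ := exists_convInv K (toConv (AlgHom.id K (AssignedAlgebra K T)))
  let π : CKAlgebra K T →ₐc[K] AssignedAlgebra K T :=
    BialgHom.ofAlgHom (piCK K T ρ) (piCK_counit K ρ) (piCK_comul K ρ)
  refine ⟨s.ofConv.toLinearMap, s'.ofConv.toLinearMap, isHopfAlgebra_of_convInv K _ hs hs',
    isHopfAlgebra_of_convInv K _ ht ht', π, rfl, ?_⟩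
  -- An algebra morphism applied to `s * id = 1` gives a left convolution inverse of `piCK`.
  have h1 : toConv ((piCK K T ρ).comp s.ofConv) * toConv (piCK K T ρ) = 1 := by
    have h := AlgHom.comp_convMul_distrib (piCK K T ρ) s (toConv (AlgHom.id K _))
    rw [hs] at h
    refine (ofConv_injective h).symm.trans (ofConv_injective ?_)
    exact graphAlgebra_algHom_ext K fun G hG => AlgHom.commutes (piCK K T ρ) _
  -- Precomposing `id * s' = 1` with `π`, which respects coproduct and counit, gives a right
  -- inverse; left and right inverses coincide.
  have h2 : toConv (piCK K T ρ) * toConv (s'.ofConv.comp (piCK K T ρ)) = 1 := by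
    have h := AlgHom.convMul_comp_bialgHom_distrib (toConv (AlgHom.id K _)) s' π
    rw [ht'] at h
    refine (ofConv_injective h).symm.trans (ofConv_injective ?_)
    refine graphAlgebra_algHom_ext K fun G hG => ?_
    exact congrArg (algebraMap K _) (AlgHom.congr_fun (piCK_counit K ρ) _)
  exact fun x => AlgHom.congr_fun (toConv_injective (left_inv_eq_right_inv h1 h2)) x
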